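/- Let $\theta$ denote the median of the $\chi^2_1$ distribution, $\theta=0.4549\ldots$. Fix a truncation parameter $\alpha_y\ge 3$, a normalizing constant $\kappa$ and an accuracy $\delta$ such that either $\kappa=\theta$ and $\delta>0$ is arbitrary, or $\kappa=0.455$ (the rounded value of $\theta$) and $\delta>\left|\sqrt{\theta/0.455}-1\right|$ (a number less than $10^{-4}$). Then there are constants $c,s,c_0,C>0$, depending only on $\alpha_y,\kappa,\delta$, such that the following holds for all $n$, all $m>c_0n$ and every $x\in\mathbb{R}^n$. Let $a_1,\dots,a_m\in\mathbb{R}^n$ be random vectors whose $mn$ entries are i.i.d. $\mathcal{N}(0,1)$, and let $$y_i=\langle a_i,x\rangle^2+w_i+\eta_i,\qquad i=1,\dots,m,$$ where almost surely the dense noise satisfies $\|w\|_\infty\le c\|x\|^2$ and the outliers satisfy $\|\eta\|_0\le sm$; apart from this $w$ and $\eta$ are arbitrary, and they may be random and depend on the $a_i$. Let $\mathrm{med}(y)=\inf\{t: \#\{i:y_i\le t\}\ge m/2\}$ be the sample median, put $\lambda_0=\sqrt{\mathrm{med}(y)/\kappa}$ (read as $0$ if $\mathrm{med}(y)<0$),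 and let $z^{(0)}=\lambda_0\tilde z$, where $\tilde z$ is any unit eigenvector for the largest eigenvalue of $$Y=\frac1m\sum_{i=1}^m y_i\,a_ia_i^T\,\mathbf{1}_{\{|y_i|\le\alpha_y^2\lambda_0^2\}}.$$ Then, with probability at least $1-\exp(-Cm)$, $$\mathrm{dist}(z^{(0)},x):=\min\{\|z^{(0)}+x\|,\|z^{(0)}-x\|\}\le\delta\|x\|$$ for every such choice of $\tilde z$. -/

import Mathlib

open MeasureTheory ProbabilityTheory

noncomputable section

namespace MedianSpectral

/-- The generalized `p`-quantile `inf {t : F t ≥ p}` of a cumulative distribution function `F`. -/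
def quantile (F : ℝ → ℝ) (p : ℝ) : ℝ := sInf {t : ℝ | p ≤ F t}

/-- The empirical distribution function of the samples `y 0, …, y (m - 1)`. -/
def empiricalCDF {m : ℕ} (y : Fin m → ℝ) (t : ℝ) : ℝ :=
  ((Finset.univ.filter fun i => y i ≤ t).card : ℝ) / m

/-- The sample median: the `1/2`-quantile of the empirical distribution. -/
def sampleMedian {m : ℕ} (y : Fin m → ℝ) : ℝ := quantile (empiricalCDF y) (1 / 2)

/-- The median of the chi-square distribution with one degree of freedom, that is, of the law of
`ξ ^ 2` for a standard Gaussian `ξ`. Numerically it is `0.4549…`. -/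
def chiSqMedian : ℝ :=
  quantile (cdf ((gaussianReal 0 1).map fun t : ℝ => t ^ 2)) (1 / 2)

/-- The distance of two vectors up to a global sign. -/
def signDist {n : ℕ} (z x : EuclideanSpace ℝ (Fin n)) : ℝ := min ‖z + x‖ ‖z - x‖

/-- The measurements `y i = ⟨a i, x⟩ ^ 2 + w i + η i`. -/
def measurements {m n : ℕ} (a : Fin m → EuclideanSpace ℝ (Fin n)) (x : EuclideanSpace ℝ (Fin n))
    (w η : Fin m → ℝ) (i : Fin m) : ℝ :=
  (inner ℝ (a i) x) ^ 2 + w i + η i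

/-- The scale `√(med(y) / κ)`, where `κ` is the normalizing constant. -/
def initScale {m : ℕ} (κ : ℝ) (y : Fin m → ℝ) : ℝ := √(sampleMedian y / κ)

open Classical in
/-- The truncated matrix `(1/m) ∑ i, y i • (a i)(a i)ᵀ • 1{|y i| ≤ α² λ₀²}`, where `λ₀` is the
scale computed from `y`. -/
def initMatrix {m n : ℕ} (κ α : ℝ) (a : Fin m → EuclideanSpace ℝ (Fin n)) (y : Fin m → ℝ) :
    Matrix (Fin n) (Fin n) ℝ :=
  (1 / m : ℝ) • ∑ i, if |y i| ≤ α ^ 2 * initScale κ y ^ 2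
    then y i • Matrix.vecMulVec (a i) (a i) else 0

/-- `v` is a unit eigenvector of `Y` for its largest eigenvalue. -/
def IsLeadingEigenvector {n : ℕ} (Y : Matrix (Fin n) (Fin n) ℝ) (v : EuclideanSpace ℝ (Fin n)) :
    Prop :=
  ‖v‖ = 1 ∧ ∃ l : ℝ, Matrix.toEuclideanLin Y v = l • v ∧
    ∀ l' : ℝ, Module.End.HasEigenvalue (Matrix.toEuclideanLin Y) l' → l' ≤ l

/-- `z` is an output of the median-truncated spectral method: a leading unit eigenvector of the
truncated matrix, multiplied by the scale. (It is determined at best up to its sign.) -/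
def IsSpectralInit {m n : ℕ} (κ α : ℝ) (a : Fin m → EuclideanSpace ℝ (Fin n)) (y : Fin m → ℝ)
    (z : EuclideanSpace ℝ (Fin n)) : Prop :=
  ∃ v, IsLeadingEigenvector (initMatrix κ α a y) v ∧ z = initScale κ y • v

/-- The method always has an output in positive dimension. -/
theorem exists_isSpectralInit {m n : ℕ} (hn : 0 < n) (κ α : ℝ)
    (a : Fin m → EuclideanSpace ℝ (Fin n)) (y : Fin m → ℝ) : ∃ z, IsSpectralInit κ α a y z := by
  have hH : (initMatrix κ α a y).IsHermitian := by
    unfold initMatrix Matrix.IsHermitian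
    rw [Matrix.conjTranspose_smul, Matrix.conjTranspose_sum]
    congr 1
    refine Finset.sum_congr rfl fun i _ => ?_
    split_ifs
    · ext j k
      simp [Matrix.vecMulVec_apply, mul_comm]
    · simp
  have hS := Matrix.isSymmetric_toEuclideanLin_iff.2 hH
  set T := Matrix.toEuclideanLin (initMatrix κ α a y) with hT
  have : Nonempty (Fin n) := ⟨⟨0, hn⟩⟩
  have hfin : Set.Finite {l : ℝ | Module.End.HasEigenvalue T l} := Module.End.finite_hasEigenvalue T
  obtain ⟨l, hl, hmax⟩ := Set.exists_max_image _ id hfin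
    ⟨_, hS.hasEigenvalue_iSup_of_finiteDimensional⟩
  obtain ⟨u, hu⟩ := Module.End.HasEigenvalue.exists_hasEigenvector hl
  refine ⟨_, (‖u‖⁻¹ : ℝ) • u, ⟨?_, l, ?_, fun l' h => hmax l' h⟩, rfl⟩
  · rw [norm_smul, norm_inv, norm_norm, inv_mul_cancel₀ (norm_ne_zero_iff.2 hu.2)]
  · rw [map_smul, hu.apply_eq_smul, smul_comm]

end MedianSpectral

end

noncomputable section

namespace MedianSpectral

universe u

/-! ### Moments of the standard Gaussian -/

section GaussianMoments

/-! Write `x = ‖x‖ u` and divide everything by `‖x‖²`, so that the clean samples are `⟨a i, u⟩²`.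
The law of `g²`, `g` standard Gaussian, puts mass below 1/2 under `θ - ε` and above 1/2 under `θ +
ε`. The empirical counts inherit this with a margin that a few outliers cannot use up, so the sample
median is within `ε + c` of `θ`. Hence the truncation level is close to the constant `T = α²θ/κ`.

Let `f g = g² 1{g² ≤ T}` (`truncSq`). The quadratic form of the normalized matrix is close,
uniformly on the unit sphere, to `(1/m) ∑ f(⟨a i, u⟩) ⟨a i, v⟩²`, which has mean `⟨v,u⟩² A + (1 -
⟨v,u⟩²) B` with `A = E[f(g) g²]` and `B = E[f(g)]`. Moments 1, 3, 15 give `A - B ≥ 2 - 15/T`, and `α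
≥ 3` makes this positive. A leading eigenvector does at least as well as `u`, which forces `1 -
⟨v,u⟩²` to be small; this and the median estimate bound the distance.

Since `w` and `η` may depend on the rows, randomness enters only through events about the `a i` and
`u`. Each is `ExpRare`: a Chernoff bound, with a union over a sphere net when all directions `v` are
involved. Off these events `signDist_le_of_regular` is deterministic and holds for every admissible
noise. Corrupted indices, and those with `⟨a i, u⟩²` near the jump of `f` at `T`, are few;
`expRare_excess` makes their share of the quadratic form small in all directions at once. -/

theorem integrable_pow_gaussianReal (k : ℕ) :
    Integrable (fun t : ℝ => t ^ k) (gaussianReal 0 1) :=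
  integrable_pow_of_integrable_exp_mul (X := fun t : ℝ => t) one_ne_zero
    (integrable_exp_mul_gaussianReal 1) (by simpa using integrable_exp_mul_gaussianReal (-1)) k

theorem hasDerivAt_gaussianPDFReal_zero_one (x : ℝ) :
    HasDerivAt (gaussianPDFReal 0 1) (-(x * gaussianPDFReal 0 1 x)) x := by
  have h : HasDerivAt (fun x : ℝ => -x ^ 2 / 2) (-x) x := by
    have := ((hasDerivAt_pow 2 x).neg).div_const 2
    refine this.congr_deriv ?_
    push_cast
    ring
  have e : gaussianPDFReal 0 1 = fun x => (√(2 * Real.pi))⁻¹ * Real.exp (-x ^ 2 / 2) := by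
    ext y
    simp [gaussianPDFReal]
  rw [e]
  exact (h.exp.const_mul (√(2 * Real.pi))⁻¹).congr_deriv (by ring)

/-- Integration by parts, using that the density satisfies `φ' = -x φ`. -/
theorem integral_pow_add_two_gaussianReal (k : ℕ) :
    ∫ t, t ^ (k + 2) ∂(gaussianReal 0 1) = (k + 1) * ∫ t, t ^ k ∂(gaussianReal 0 1) := by
  have hint : ∀ j : ℕ, Integrable (fun x : ℝ => gaussianPDFReal 0 1 x * x ^ j) := by
    intro j
    have := integrable_pow_gaussianReal j
    rw [gaussianReal_of_var_ne_zero 0 one_ne_zero, integrable_withDensity_iff_integrable_smul'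
      (measurable_gaussianPDF 0 1) (by simp [gaussianPDF])] at this
    simpa using this
  simp only [integral_gaussianReal_eq_integral_smul (μ := 0) (v := 1) one_ne_zero, smul_eq_mul]
  have key := integral_mul_deriv_eq_deriv_mul_of_integrable
    (u := fun x : ℝ => x ^ (k + 1)) (v := gaussianPDFReal 0 1)
    (u' := fun x : ℝ => (k + 1 : ℝ) * x ^ k) (v' := fun x => -(x * gaussianPDFReal 0 1 x))
    (fun x _ => by simpa using hasDerivAt_pow (k + 1) x)
    (fun x _ => hasDerivAt_gaussianPDFReal_zero_one x)
    (by
      refine (hint (k + 2)).neg.congr (ae_of_all _ fun x => ?_)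
      simp only [Pi.mul_apply, Pi.neg_apply]; ring)
    (by
      refine ((hint k).const_mul (k + 1 : ℝ)).congr (ae_of_all _ fun x => ?_)
      simp only [Pi.mul_apply]; ring)
    (by
      refine (hint (k + 1)).congr (ae_of_all _ fun x => ?_)
      simp only [Pi.mul_apply]; ring)
  rw [← integral_const_mul]
  have e1 : ∫ x : ℝ, x ^ (k + 1) * -(x * gaussianPDFReal 0 1 x) =
      -∫ x : ℝ, gaussianPDFReal 0 1 x * x ^ (k + 2) := by
    rw [← integral_neg]; congr 1; ext x; ring
  rw [e1, neg_inj] at key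
  rw [key]
  congr 1; ext x; ring

theorem integral_sq_gaussianReal : ∫ t, t ^ 2 ∂(gaussianReal 0 1) = 1 := by
  rw [integral_pow_add_two_gaussianReal 0]; simp

theorem integral_pow_four_gaussianReal : ∫ t, t ^ 4 ∂(gaussianReal 0 1) = 3 := by
  rw [integral_pow_add_two_gaussianReal 2, integral_sq_gaussianReal]; norm_num

theorem integral_pow_six_gaussianReal : ∫ t, t ^ 6 ∂(gaussianReal 0 1) = 15 := by
  rw [integral_pow_add_two_gaussianReal 4, integral_pow_four_gaussianReal]; norm_num

/-- Fernique gives an integrable `exp (C t²)`; half of the exponent pays for the polynomial factor.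
The integral bounds the second-order term of the moment generating function in `exists_chernoff`. -/
theorem exists_integrable_sq_mul_exp_gaussianReal :
    ∃ c : ℝ, 0 < c ∧
      Integrable (fun t : ℝ => (1 + t ^ 2) ^ 2 * Real.exp (c * (1 + t ^ 2))) (gaussianReal 0 1) := by
  obtain ⟨C, hC, hi⟩ := IsGaussian.exists_integrable_exp_sq (gaussianReal 0 1)
  refine ⟨C / 2, by positivity, ?_⟩
  refine (hi.const_mul (2 / (C / 2) ^ 2 * Real.exp C)).mono' (by fun_prop) (ae_of_all _ fun t => ?_)
  have h := Real.quadratic_le_exp_of_nonneg (x := C / 2 * (1 + t ^ 2)) (by positivity)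
  have h1 : (C / 2) ^ 2 * (1 + t ^ 2) ^ 2 ≤ 2 * Real.exp (C / 2 * (1 + t ^ 2)) := by
    have : 0 ≤ C / 2 * (1 + t ^ 2) := by positivity
    nlinarith
  have h2 : (1 + t ^ 2) ^ 2 ≤ 2 / (C / 2) ^ 2 * Real.exp (C / 2 * (1 + t ^ 2)) := by
    rw [div_mul_eq_mul_div, le_div_iff₀ (by positivity)]; linarith
  rw [Real.norm_of_nonneg (by positivity)]
  calc _ ≤ (2 / (C / 2) ^ 2 * Real.exp (C / 2 * (1 + t ^ 2))) * Real.exp (C / 2 * (1 + t ^ 2)) := by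
        gcongr
    _ = _ := by
        rw [mul_assoc, mul_assoc, ← Real.exp_add, ← Real.exp_add, Real.norm_eq_abs, sq_abs]
        ring_nf

end GaussianMoments

/-! ### The median of the chi-square law -/

section ChiSqMedian

theorem cdf_chiSq (t : ℝ) :
    cdf ((gaussianReal 0 1).map fun t : ℝ => t ^ 2) t = (gaussianReal 0 1).real {x | x ^ 2 ≤ t} := by
  have : IsProbabilityMeasure ((gaussianReal 0 1).map fun t : ℝ => t ^ 2) :=
    Measure.isProbabilityMeasure_map (by fun_prop)
  rw [cdf_eq_real, map_measureReal_apply (by fun_prop) measurableSet_Iic]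
  rfl

theorem gaussianReal_sq_le_bound {t : ℝ} (ht : 0 ≤ t) :
    (gaussianReal 0 1).real {x | x ^ 2 ≤ t} ≤ 2 * √t / √(2 * Real.pi) := by
  have hs : {x : ℝ | x ^ 2 ≤ t} = Set.Icc (-√t) (√t) := by
    ext x
    exact Real.sq_le ht
  rw [hs, measureReal_def, gaussianReal_apply_eq_integral 0 one_ne_zero,
    ENNReal.toReal_ofReal (integral_nonneg fun x => gaussianPDFReal_nonneg 0 1 x)]
  calc ∫ x in Set.Icc (-√t) (√t), gaussianPDFReal 0 1 x
      ≤ ∫ x in Set.Icc (-√t) (√t), (√(2 * Real.pi))⁻¹ := by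
        refine setIntegral_mono (integrable_gaussianPDFReal 0 1).integrableOn
          (integrableOn_const (by simp) ENNReal.coe_ne_top) fun x => ?_
        simp only [gaussianPDFReal, NNReal.coe_one, mul_one]
        refine mul_le_of_le_one_right (by positivity) (Real.exp_le_one_iff.2 ?_)
        have := sq_nonneg (x - 0)
        linarith
    _ = _ := by
        simp [two_mul]
        ring_nf

theorem nonempty_chiSqMedian_set :
    {t : ℝ | 1 / 2 ≤ cdf ((gaussianReal 0 1).map fun t : ℝ => t ^ 2) t}.Nonempty := by
  have h := tendsto_cdf_atTop ((gaussianReal 0 1).map fun t : ℝ => t ^ 2)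
  obtain ⟨t, ht⟩ := (h.eventually (lt_mem_nhds (by norm_num : (1 / 2 : ℝ) < 1))).exists
  exact ⟨t, ht.le⟩

/-- Bounding the density by its peak gives a crude estimate, but it suffices both for `θ > 0` and
for `T > 15/2` when `κ = 0.455`. -/
theorem pi_div_eight_le_of_half_le {t : ℝ}
    (ht : 1 / 2 ≤ cdf ((gaussianReal 0 1).map fun t : ℝ => t ^ 2) t) : Real.pi / 8 ≤ t := by
  rw [cdf_chiSq] at ht
  by_cases h0 : 0 ≤ t
  · have h1 := ht.trans (gaussianReal_sq_le_bound h0)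
    have hpi := Real.pi_pos
    rw [le_div_iff₀ (by positivity)] at h1
    have h2 : (1 / 2 * √(2 * Real.pi)) ^ 2 ≤ (2 * √t) ^ 2 := by gcongr
    rw [mul_pow, mul_pow, Real.sq_sqrt (by positivity), Real.sq_sqrt h0] at h2
    linarith
  · have : {x : ℝ | x ^ 2 ≤ t} = ∅ := by
      ext x
      simp only [Set.mem_ofPred_eq, Set.mem_empty_iff_false, iff_false, not_le]
      nlinarith [sq_nonneg x]
    rw [this] at ht
    norm_num at ht

theorem pi_div_eight_le_chiSqMedian : Real.pi / 8 ≤ chiSqMedian :=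
  le_csInf nonempty_chiSqMedian_set fun _ => pi_div_eight_le_of_half_le

theorem chiSqMedian_pos : 0 < chiSqMedian :=
  (div_pos Real.pi_pos (by norm_num)).trans_le pi_div_eight_le_chiSqMedian

theorem gaussianReal_sq_le_lt_half {t : ℝ} (ht : t < chiSqMedian) :
    (gaussianReal 0 1).real {x | x ^ 2 ≤ t} < 1 / 2 := by
  by_contra! h
  rw [← cdf_chiSq] at h
  exact (csInf_le ⟨Real.pi / 8, fun _ => pi_div_eight_le_of_half_le⟩ h).not_gt ht

/-- Some `r < t` already has mass at least 1/2, and the Gaussian charges the interval `(√r, √t)`. -/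
theorem half_lt_gaussianReal_sq_le {t : ℝ} (ht : chiSqMedian < t) :
    1 / 2 < (gaussianReal 0 1).real {x | x ^ 2 ≤ t} := by
  obtain ⟨r, hr, hrt⟩ := exists_lt_of_csInf_lt nonempty_chiSqMedian_set ht
  have hr0 : 0 < r := (div_pos Real.pi_pos (by norm_num)).trans_le (pi_div_eight_le_of_half_le hr)
  rw [Set.mem_ofPred_eq, cdf_chiSq] at hr
  refine hr.trans_lt ?_
  have hsub : Set.Ioo (√r) (√t) ⊆ {x : ℝ | x ^ 2 ≤ t} \ {x | x ^ 2 ≤ r} := by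
    rintro x ⟨h1, h2⟩
    have hx := (Real.sqrt_nonneg r).trans_lt h1
    refine ⟨((Real.lt_sqrt hx.le).1 h2).le, ?_⟩
    simpa using (Real.sqrt_lt' hx).1 h1
  have hpos : 0 < (gaussianReal 0 1).real (Set.Ioo (√r) (√t)) := by
    rw [measureReal_def, ENNReal.toReal_pos_iff]
    refine ⟨pos_iff_ne_zero.2 fun h => ?_, measure_lt_top _ _⟩
    have := gaussianReal_absolutelyContinuous' 0 one_ne_zero h
    rw [Real.volume_Ioo, ENNReal.ofReal_eq_zero] at this
    linarith [Real.sqrt_lt_sqrt hr0.le hrt]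
  have := measureReal_mono (μ := gaussianReal 0 1) hsub
  rw [measureReal_sdiff (s₁ := {x : ℝ | x ^ 2 ≤ t}) (s₂ := {x : ℝ | x ^ 2 ≤ r})
    (fun x (hx : x ^ 2 ≤ r) => hx.trans hrt.le)
    (measurableSet_le (by fun_prop) (by fun_prop))] at this
  linarith

/-- The law of `g²` has no atom at `T`, so shrinking neighbourhoods lose their mass. This limits how
many samples a small change of threshold can affect. -/
theorem exists_gaussianReal_abs_sq_sub_le {T ρ : ℝ} (hρ : 0 < ρ) :
    ∃ ε : ℝ, 0 < ε ∧ (gaussianReal 0 1).real {x | |x ^ 2 - T| ≤ ε} < ρ := by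
  set ν := (gaussianReal 0 1).map fun t : ℝ => t ^ 2
  have : IsProbabilityMeasure ν := Measure.isProbabilityMeasure_map (by fun_prop)
  have h0 : ν {T} = 0 := by
    rw [Measure.map_apply (by fun_prop) (measurableSet_singleton T)]
    have : NullSingletonClass (gaussianReal 0 1) := nullSingletonClass_gaussianReal one_ne_zero
    refine Set.Finite.measure_zero ?_ _
    refine (Set.toFinite {√T, -√T}).subset fun x hx => ?_
    have : x ^ 2 = T := hx
    rw [← this, Real.sqrt_sq_eq_abs]
    rcases abs_cases x with h | h <;> simp [h.1]
  have h := tendsto_measure_cthickening_of_isCompact (μ := ν) (isCompact_singleton (x := T))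
  rw [h0] at h
  have h1 := (h.mono_left (nhdsWithin_le_nhds (s := Set.Ioi 0))).eventually
    (gt_mem_nhds (ENNReal.ofReal_pos.2 hρ) : ∀ᶠ x in nhds (0 : ENNReal), x < ENNReal.ofReal ρ)
  obtain ⟨ε, hε, hε0⟩ := (h1.and (self_mem_nhdsWithin : Set.Ioi (0 : ℝ) ∈ nhdsWithin 0 _)).exists
  refine ⟨ε, hε0, ?_⟩
  rw [Metric.cthickening_singleton _ (le_of_lt hε0),
    Measure.map_apply (by fun_prop) measurableSet_closedBall] at hε
  rw [measureReal_def]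
  refine (ENNReal.lt_ofReal_iff_toReal_lt (measure_ne_top _ _)).1 ?_
  simpa [Set.preimage, Real.dist_eq] using hε

end ChiSqMedian

/-! ### Gaussian rows and their one-dimensional marginals -/

section GaussianRows

theorem hasLaw_row_stdGaussian {n m : ℕ} {Ω : Type*} [MeasurableSpace Ω] {P : Measure Ω}
    {a : Fin m → Ω → EuclideanSpace ℝ (Fin n)}
    (hlaw : ∀ i j, HasLaw (fun ω => a i ω j) (gaussianReal 0 1) P)
    (hind : iIndepFun (fun (p : Fin m × Fin n) ω => a p.1 ω p.2) P) (i : Fin m) :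
    HasLaw (a i) (stdGaussian (EuclideanSpace ℝ (Fin n))) P := by
  have h1 : iIndepFun (fun (j : Fin n) ω => a i ω j) P :=
    hind.precomp (g := fun j : Fin n => (i, j)) (Prod.mk_right_injective i)
  have h2 := h1.hasLaw_infinitePi (hlaw i) (aemeasurable_pi_lambda _ fun j => (hlaw i j).aemeasurable)
  rw [Measure.infinitePi_eq_pi] at h2
  rw [← map_pi_eq_stdGaussian]
  exact HasLaw.comp (Y := WithLp.toLp 2) ⟨by fun_prop, rfl⟩ h2

theorem iIndepFun_rows {n m : ℕ} {Ω : Type*} [MeasurableSpace Ω] {P : Measure Ω}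
    {a : Fin m → Ω → EuclideanSpace ℝ (Fin n)}
    (hlaw : ∀ i j, HasLaw (fun ω => a i ω j) (gaussianReal 0 1) P)
    (hind : iIndepFun (fun (p : Fin m × Fin n) ω => a p.1 ω p.2) P) : iIndepFun a P := by
  have := hind.isProbabilityMeasure
  have hm : ∀ i, AEMeasurable (fun ω (j : Fin n) => a i ω j) P :=
    fun i => aemeasurable_pi_lambda _ fun j => (hlaw i j).aemeasurable
  have h2 := hind.hasLaw_infinitePi (fun p : Fin m × Fin n => hlaw p.1 p.2)
    (aemeasurable_pi_lambda _ fun p : Fin m × Fin n => (hlaw p.1 p.2).aemeasurable)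
  have h3 : iIndepFun (fun i ω (j : Fin n) => a i ω j) P := by
    rw [iIndepFun_iff_map_fun_eq_infinitePi_map₀' hm]
    have h4 := congrArg (Measure.map (MeasurableEquiv.curry (Fin m) (Fin n) ℝ)) h2.map_eq
    rw [AEMeasurable.map_map_of_aemeasurable (by fun_prop) h2.aemeasurable,
      Measure.infinitePi_map_curry (fun _ _ => gaussianReal 0 1)] at h4
    refine Eq.trans h4 ?_
    congr 1
    ext1 i
    have h1 : iIndepFun (fun (j : Fin n) ω => a i ω j) P :=
      hind.precomp (g := fun j : Fin n => (i, j)) (Prod.mk_right_injective i)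
    exact (h1.hasLaw_infinitePi (hlaw i) (hm i)).map_eq.symm
  exact h3.comp₀ (g := fun _ => WithLp.toLp 2) hm fun i => by fun_prop

theorem hasLaw_inner_stdGaussian {n : ℕ} {v : EuclideanSpace ℝ (Fin n)} (hv : ‖v‖ = 1) :
    HasLaw (fun b => inner ℝ b v) (gaussianReal 0 1) (stdGaussian (EuclideanSpace ℝ (Fin n))) := by
  have h := (IsGaussian.hasGaussianLaw_id (μ := stdGaussian (EuclideanSpace ℝ (Fin n)))).map_fun
    (innerSL ℝ v)
  refine ⟨by fun_prop, ?_⟩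
  have e : (fun b : EuclideanSpace ℝ (Fin n) => inner ℝ b v) = fun b => innerSL ℝ v (id b) := by
    ext b; simp [real_inner_comm]
  rw [e, h.map_eq_gaussianReal]
  have h1 := integral_strongDual_stdGaussian (innerSL ℝ v)
  have h2 := variance_dual_stdGaussian (innerSL ℝ v)
  simp only [id] at *
  rw [h1, h2, innerSL_apply_norm, hv]
  simp

theorem integral_comp_inner_stdGaussian {n : ℕ} {v : EuclideanSpace ℝ (Fin n)} (hv : ‖v‖ = 1)
    {f : ℝ → ℝ} (hf : Measurable f) :
    ∫ b, f (inner ℝ b v) ∂(stdGaussian (EuclideanSpace ℝ (Fin n))) = ∫ t, f t ∂(gaussianReal 0 1) := by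
  rw [← (hasLaw_inner_stdGaussian hv).map_eq, integral_map (by fun_prop) hf.aestronglyMeasurable]

theorem integrable_comp_inner_stdGaussian {n : ℕ} {v : EuclideanSpace ℝ (Fin n)} (hv : ‖v‖ = 1)
    {f : ℝ → ℝ} (hf : Integrable f (gaussianReal 0 1)) :
    Integrable (fun b => f (inner ℝ b v)) (stdGaussian (EuclideanSpace ℝ (Fin n))) := by
  rw [← (hasLaw_inner_stdGaussian hv).map_eq] at hf
  exact hf.comp_aemeasurable (by fun_prop)

end GaussianRows

/-! ### A Chernoff bound with uniform constants -/

section Chernoff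

theorem exp_le_one_add_add_sq_mul_exp {x y : ℝ} (h : |x| ≤ y) :
    Real.exp x ≤ 1 + x + y ^ 2 * Real.exp y := by
  have hy : 0 ≤ y := (abs_nonneg x).trans h
  have he := Real.one_le_exp hy
  obtain ⟨h1, h2⟩ := abs_le.1 h
  rcases le_or_gt |x| 1 with hx | hx
  · have h3 := (abs_le.1 (Real.abs_exp_sub_one_sub_id_le hx)).2
    have h4 : x ^ 2 ≤ y ^ 2 := sq_le_sq' h1 h2
    nlinarith [sq_nonneg y]
  · have hy1 : 1 < y := hx.trans_le h
    rcases le_total x 0 with h0 | h0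
    · have h3 := Real.exp_le_one_iff.2 h0
      nlinarith [sq_nonneg y]
    · have h3 := Real.exp_le_exp.2 h2
      have h4 : 1 * Real.exp y ≤ y ^ 2 * Real.exp y :=
        mul_le_mul_of_nonneg_right (one_le_pow₀ hy1.le) (by linarith)
      linarith

/-- The rate depends on `K` and `τ` only, which the union over a net requires: domination by a
function of one marginal bounds the moment generating function by a one-dimensional Gaussian
integral. -/
theorem exists_chernoff {K τ : ℝ} (hK : 0 < K) (hτ : 0 < τ) :
    ∃ C : ℝ, 0 < C ∧ ∀ (n m : ℕ) (v : EuclideanSpace ℝ (Fin n)), ‖v‖ = 1 →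
      ∀ H : EuclideanSpace ℝ (Fin n) → ℝ, Measurable H →
      (∀ b, |H b| ≤ K * (1 + (inner ℝ b v) ^ 2)) →
      ∀ (Ω : Type*) [MeasurableSpace Ω] (P : Measure Ω) [IsProbabilityMeasure P]
        (a : Fin m → Ω → EuclideanSpace ℝ (Fin n)),
        (∀ i, HasLaw (a i) (stdGaussian (EuclideanSpace ℝ (Fin n))) P) → iIndepFun a P →
        P {ω | m * ((∫ b, H b ∂(stdGaussian (EuclideanSpace ℝ (Fin n)))) + τ) ≤ ∑ i, H (a i ω)} ≤
          ENNReal.ofReal (Real.exp (-(C * m))) := by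
  obtain ⟨c, hc, hi⟩ := exists_integrable_sq_mul_exp_gaussianReal
  set Q := ∫ t, (1 + t ^ 2) ^ 2 * Real.exp (c * (1 + t ^ 2)) ∂(gaussianReal 0 1) with hQ
  have hQ0 : 0 ≤ Q := integral_nonneg fun t => by positivity
  -- The first bound keeps the exponential integrable; the second makes the quadratic error at most
  -- half of the gain `l * τ`.
  set l := min (c / K) (τ / (2 * (K ^ 2 * Q + 1))) with hl
  have hl0 : 0 < l := by positivity
  have hlK : l * K ≤ c := by
    rw [← le_div_iff₀ hK]; exact min_le_left _ _
  have hlQ : l * (K ^ 2 * Q) ≤ τ / 2 := by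
    have h1 : l ≤ τ / (2 * (K ^ 2 * Q + 1)) := min_le_right _ _
    rw [le_div_iff₀ (by positivity)] at h1
    nlinarith
  refine ⟨l * τ / 2, by positivity, ?_⟩
  intro n m v hv H hHm hH Ω _ P _ a hlaw hind
  set γ := stdGaussian (EuclideanSpace ℝ (Fin n))
  have hdom : ∀ b, |l * H b| ≤ l * K * (1 + (inner ℝ b v) ^ 2) := fun b => by
    rw [abs_mul, abs_of_pos hl0, mul_assoc]
    exact mul_le_mul_of_nonneg_left (hH b) hl0.le
  have hiv := integrable_comp_inner_stdGaussian hv hi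
  have hle : ∀ b, Real.exp (l * H b) ≤ 1 + l * H b + (l * K) ^ 2 *
      ((1 + (inner ℝ b v) ^ 2) ^ 2 * Real.exp (c * (1 + (inner ℝ b v) ^ 2))) := fun b => by
    refine (exp_le_one_add_add_sq_mul_exp (hdom b)).trans ?_
    rw [mul_pow, mul_assoc]
    gcongr
  have hsq : Integrable (fun t : ℝ => K * (1 + t ^ 2)) (gaussianReal 0 1) :=
    ((integrable_const _).add (integrable_pow_gaussianReal 2)).const_mul K
  have hHi : Integrable H γ :=
    (integrable_comp_inner_stdGaussian hv hsq).mono' hHm.aestronglyMeasurable (ae_of_all _ hH)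
  have hdi : Integrable (fun b => 1 + l * H b + (l * K) ^ 2 *
      ((1 + (inner ℝ b v) ^ 2) ^ 2 * Real.exp (c * (1 + (inner ℝ b v) ^ 2)))) γ :=
    ((integrable_const _).add (hHi.const_mul l)).add (hiv.const_mul _)
  have hei : Integrable (fun b => Real.exp (l * H b)) γ :=
    hdi.mono' (by fun_prop) (ae_of_all _ fun b => by
      rw [Real.norm_of_nonneg (Real.exp_pos _).le]; exact hle b)
  have hmgf : ∫ b, Real.exp (l * H b) ∂γ ≤ Real.exp (l * ∫ b, H b ∂γ + l * (τ / 2)) := by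
    calc ∫ b, Real.exp (l * H b) ∂γ ≤ _ := integral_mono hei hdi hle
      _ = 1 + l * ∫ b, H b ∂γ + (l * K) ^ 2 * Q := by
        have h1 : Integrable (fun b => 1 + l * H b) γ := (integrable_const _).add (hHi.const_mul l)
        rw [integral_add h1 (hiv.const_mul _),
          integral_add (integrable_const _) (hHi.const_mul l), integral_const_mul,
          integral_const_mul, integral_comp_inner_stdGaussian hv
            (f := fun t => (1 + t ^ 2) ^ 2 * Real.exp (c * (1 + t ^ 2))) (by fun_prop), ← hQ]
        simp
      _ ≤ (l * ∫ b, H b ∂γ + l * (τ / 2)) + 1 := by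
        have := mul_le_mul_of_nonneg_left hlQ hl0.le
        nlinarith
      _ ≤ _ := Real.add_one_le_exp _
  have hXi : ∀ i, Integrable (fun ω => Real.exp (l * H (a i ω))) P := fun i => by
    have := (hlaw i).map_eq ▸ hei
    exact this.comp_aemeasurable (hlaw i).aemeasurable
  have hXm : ∀ i, mgf (fun ω => H (a i ω)) P l = ∫ b, Real.exp (l * H b) ∂γ := fun i => by
    rw [← (hlaw i).map_eq, integral_map (hlaw i).aemeasurable (by fun_prop)]
    rfl
  have hXind : iIndepFun (fun i ω => H (a i ω)) P :=
    hind.comp₀ (g := fun _ => H) (fun i => (hlaw i).aemeasurable) fun i => by fun_prop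
  have hmeas : ∀ i, AEMeasurable (fun ω => H (a i ω)) P := fun i =>
    hHm.comp_aemeasurable (hlaw i).aemeasurable
  have hsumm := hXind.mgf_sum₀ (t := l) hmeas Finset.univ
  have hpos : 0 < mgf (∑ i, fun ω => H (a i ω)) P l := by
    rw [hsumm]
    exact Finset.prod_pos fun i _ => mgf_pos (hXi i)
  -- `mgf` is 0 by default when the exponential is not integrable, whereas here it is a product of
  -- positive factors.
  have hsi : Integrable (fun ω => Real.exp (l * (∑ i, fun ω => H (a i ω)) ω)) P := by
    by_contra h
    exact hpos.ne' (mgf_undef h)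
  have := measure_ge_le_exp_mul_mgf (μ := P) (X := ∑ i, fun ω => H (a i ω))
    (m * ((∫ b, H b ∂γ) + τ)) hl0.le hsi
  rw [← ofReal_measureReal (by finiteness)]
  refine ENNReal.ofReal_le_ofReal ?_
  simp only [Finset.sum_apply] at this
  refine this.trans ?_
  rw [hsumm]
  simp only [hXm, Finset.prod_const, Finset.card_univ, Fintype.card_fin]
  calc _ ≤ Real.exp (-l * (m * ((∫ b, H b ∂γ) + τ))) *
        (Real.exp (l * ∫ b, H b ∂γ + l * (τ / 2))) ^ m := by
        gcongr
    _ = _ := by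
        rw [← Real.exp_nat_mul, ← Real.exp_add]
        congr 1
        ring

end Chernoff

/-! ### Nets of the unit sphere -/

section SphereNet

open Metric Module in
-- Volume comparison: the balls of radius `ε / 2` around the points are disjoint and lie in the ball
-- of radius `1 + ε / 2`.
theorem card_le_of_separated_sphere {E : Type*} [NormedAddCommGroup E] [NormedSpace ℝ E]
    [FiniteDimensional ℝ E] {ε : ℝ} (hε : 0 < ε) (s : Finset E) (hs : ∀ c ∈ s, ‖c‖ = 1)
    (h : ∀ c ∈ s, ∀ d ∈ s, c ≠ d → ε ≤ ‖c - d‖) :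
    (s.card : ℝ) ≤ (1 + 2 / ε) ^ finrank ℝ E := by
  borelize E
  let μ : Measure E := Measure.addHaar
  have hδ : 0 < ε / 2 := by positivity
  have hρ : 0 < 1 + ε / 2 := by positivity
  have D : Set.Pairwise (s : Set E) (Function.onFun Disjoint fun c => ball c (ε / 2)) := by
    rintro c hc d hd hcd
    apply ball_disjoint_ball
    rw [dist_eq_norm, add_halves]
    exact h c hc d hd hcd
  have hsub : ⋃ c ∈ s, ball c (ε / 2) ⊆ ball (0 : E) (1 + ε / 2) := by
    refine Set.iUnion₂_subset fun x hx => ball_subset_ball' ?_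
    rw [dist_zero_right, hs x hx, add_comm]
  have I : (s.card : ENNReal) * ENNReal.ofReal ((ε / 2) ^ finrank ℝ E) * μ (ball 0 1) ≤
      ENNReal.ofReal ((1 + ε / 2) ^ finrank ℝ E) * μ (ball 0 1) := by
    calc _ = μ (⋃ c ∈ s, ball c (ε / 2)) := by
          rw [measure_biUnion_finset D fun c _ => measurableSet_ball]
          simp only [μ.addHaar_ball_of_pos _ hδ, Finset.sum_const, nsmul_eq_mul, mul_assoc]
      _ ≤ μ (ball (0 : E) (1 + ε / 2)) := measure_mono hsub
      _ = _ := by rw [μ.addHaar_ball_of_pos _ hρ]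
  have J := (ENNReal.mul_le_mul_iff_left (measure_ball_pos _ _ zero_lt_one).ne'
    measure_ball_lt_top.ne).1 I
  have K := ENNReal.toReal_mono ENNReal.ofReal_ne_top J
  rw [ENNReal.toReal_mul, ENNReal.toReal_natCast, ENNReal.toReal_ofReal (by positivity),
    ENNReal.toReal_ofReal (by positivity), ← le_div_iff₀ (by positivity), ← div_pow] at K
  have e : (1 + ε / 2) / (ε / 2) = 1 + 2 / ε := by field_simp; ring
  rwa [e] at K

/-- A separated set of maximal cardinality is a net, since any uncovered point could be added to it.
-/
theorem exists_sphere_net {E : Type*} [NormedAddCommGroup E] [NormedSpace ℝ E]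
    [FiniteDimensional ℝ E] {ε : ℝ} (hε : 0 < ε) :
    ∃ N : Finset E, (∀ v ∈ N, ‖v‖ = 1) ∧ (∀ u : E, ‖u‖ = 1 → ∃ v ∈ N, ‖u - v‖ ≤ ε) ∧
      (N.card : ℝ) ≤ (1 + 2 / ε) ^ Module.finrank ℝ E := by
  classical
  set S : Set ℕ := {k | ∃ s : Finset E, (∀ c ∈ s, ‖c‖ = 1) ∧
    (∀ c ∈ s, ∀ d ∈ s, c ≠ d → ε ≤ ‖c - d‖) ∧ s.card = k} with hS
  have hne : S.Nonempty := ⟨0, ∅, by simp⟩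
  have hbdd : BddAbove S := by
    refine ⟨⌈(1 + 2 / ε) ^ Module.finrank ℝ E⌉₊, ?_⟩
    rintro k ⟨s, h1, h2, rfl⟩
    exact_mod_cast (card_le_of_separated_sphere hε s h1 h2).trans (Nat.le_ceil _)
  obtain ⟨s, h1, h2, h3⟩ := Nat.sSup_mem hne hbdd
  refine ⟨s, h1, fun u hu => ?_, card_le_of_separated_sphere hε s h1 h2⟩
  by_contra! hcon
  have hus : u ∉ s := fun h => by
    have := hcon u h
    simp only [sub_self, norm_zero] at this
    linarith
  have hmem : (insert u s).card ∈ S := by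
    refine ⟨insert u s, ?_, ?_, rfl⟩
    · simpa [hu] using h1
    · intro c hc d hd hcd
      rcases Finset.mem_insert.1 hc with rfl | hc' <;>
        rcases Finset.mem_insert.1 hd with rfl | hd'
      · exact absurd rfl hcd
      · exact (hcon d hd').le
      · rw [norm_sub_rev]; exact (hcon c hc').le
      · exact h2 c hc' d hd' hcd
  have := le_csSup hbdd hmem
  rw [Finset.card_insert_of_notMem hus, h3] at this
  omega

end SphereNet

/-- The event `B`, depending on the dimension, the number of rows, a unit vector and the rows, has
probability at most `exp (-C m)` for i.i.d. standard Gaussian rows as soon as `m > c₀ n`. -/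
def ExpRare (B : ∀ n m : ℕ, EuclideanSpace ℝ (Fin n) → (Fin m → EuclideanSpace ℝ (Fin n)) → Prop) :
    Prop :=
  ∃ c₀ C : ℝ, 0 < c₀ ∧ 0 < C ∧ ∀ n m : ℕ, (m : ℝ) > c₀ * n →
    ∀ u : EuclideanSpace ℝ (Fin n), ‖u‖ = 1 →
    ∀ (Ω : Type u) [MeasurableSpace Ω] (P : Measure Ω) [IsProbabilityMeasure P]
      (a : Fin m → Ω → EuclideanSpace ℝ (Fin n)),
      (∀ i, HasLaw (a i) (stdGaussian (EuclideanSpace ℝ (Fin n))) P) → iIndepFun a P →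
      P {ω | B n m u (fun i => a i ω)} ≤ ENNReal.ofReal (Real.exp (-(C * m)))

/-! ### Stability of exponentially rare events -/

namespace ExpRare

variable {B B₁ B₂ : ∀ n m : ℕ, EuclideanSpace ℝ (Fin n) → (Fin m → EuclideanSpace ℝ (Fin n)) → Prop}

theorem mono (h : ExpRare.{u} B₁)
    (hB : ∀ n m u a, 0 < m → ‖u‖ = 1 → B₂ n m u a → B₁ n m u a) :
    ExpRare.{u} B₂ := by
  obtain ⟨c₀, C, h0, hC, h⟩ := h
  refine ⟨c₀, C, h0, hC, fun n m hm u hu Ω _ P _ a hlaw hind => ?_⟩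
  have hm0 : 0 < m := by
    have : (0 : ℝ) < m := lt_of_le_of_lt (by positivity) hm
    exact_mod_cast this
  exact (measure_mono fun ω hω => hB n m u _ hm0 hu hω).trans (h n m hm u hu Ω P a hlaw hind)

theorem or (h₁ : ExpRare.{u} B₁) (h₂ : ExpRare.{u} B₂) :
    ExpRare.{u} fun n m u a => B₁ n m u a ∨ B₂ n m u a := by
  obtain ⟨c₁, C₁, h1, hC₁, h₁⟩ := h₁
  obtain ⟨c₂, C₂, h2, hC₂, h₂⟩ := h₂
  set C := min C₁ C₂ / 2 with hC
  have hC0 : 0 < C := by positivity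
  -- A unit vector forces `n ≥ 1`, so the entry `1 / C` gives `C * m ≥ 1`. Halving the rate then
  -- absorbs the factor 2 of the union bound.
  refine ⟨max (max c₁ c₂) (1 / C), C, by positivity, hC0, fun n m hm u hu Ω _ P _ a hlaw hind => ?_⟩
  have hm1 : (m : ℝ) > c₁ * n := lt_of_le_of_lt
    (mul_le_mul_of_nonneg_right ((le_max_left _ _).trans (le_max_left _ _)) (by positivity)) hm
  have hm2 : (m : ℝ) > c₂ * n := lt_of_le_of_lt
    (mul_le_mul_of_nonneg_right ((le_max_right _ _).trans (le_max_left _ _)) (by positivity)) hm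
  have hm3 : (m : ℝ) > 1 / C * n := lt_of_le_of_lt
    (mul_le_mul_of_nonneg_right (le_max_right _ _) (by positivity)) hm
  have hn : (1 : ℝ) ≤ n := by
    have : n ≠ 0 := by
      rintro rfl
      rw [Subsingleton.elim u 0, norm_zero] at hu
      exact zero_ne_one hu
    exact_mod_cast Nat.one_le_iff_ne_zero.2 this
  have hCm : 1 ≤ C * m := by
    have : 1 / C * 1 ≤ 1 / C * n := by gcongr
    rw [mul_one] at this
    have := this.trans hm3.le
    rwa [div_le_iff₀ hC0, mul_comm] at this
  have e1 : Real.exp (-(C₁ * m)) ≤ Real.exp (-(2 * (C * m))) := by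
    rw [Real.exp_le_exp, neg_le_neg_iff, ← mul_assoc]
    gcongr
    rw [hC]; linarith [min_le_left C₁ C₂]
  have e2 : Real.exp (-(C₂ * m)) ≤ Real.exp (-(2 * (C * m))) := by
    rw [Real.exp_le_exp, neg_le_neg_iff, ← mul_assoc]
    gcongr
    rw [hC]; linarith [min_le_right C₁ C₂]
  have e3 : 2 * Real.exp (-(2 * (C * m))) ≤ Real.exp (-(C * m)) := by
    have h3 : -(2 * (C * m)) = -(C * m) + -(C * m) := by ring
    have h4 := Real.add_one_le_exp (C * m)
    have h5 : Real.exp (C * m) * Real.exp (-(C * m)) = 1 := by rw [← Real.exp_add]; simp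
    have h6 := Real.exp_pos (-(C * m))
    rw [h3, Real.exp_add]
    have : 2 * Real.exp (-(C * m)) ≤ 1 := by
      rw [← h5]
      exact mul_le_mul_of_nonneg_right (by linarith) h6.le
    nlinarith
  calc P {ω | B₁ n m u (fun i => a i ω) ∨ B₂ n m u (fun i => a i ω)}
      ≤ P {ω | B₁ n m u (fun i => a i ω)} + P {ω | B₂ n m u (fun i => a i ω)} :=
        measure_union_le _ _
    _ ≤ ENNReal.ofReal (Real.exp (-(C₁ * m))) + ENNReal.ofReal (Real.exp (-(C₂ * m))) :=
        add_le_add (h₁ n m hm1 u hu Ω P a hlaw hind) (h₂ n m hm2 u hu Ω P a hlaw hind)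
    _ ≤ _ := by
        rw [← ENNReal.ofReal_add (Real.exp_pos _).le (Real.exp_pos _).le]
        exact ENNReal.ofReal_le_ofReal (by linarith)

end ExpRare

/-! ### Deviations in one direction and over a net -/

theorem expRare_mean_deviation {K τ : ℝ} (hK : 0 < K) (hτ : 0 < τ) {ψ : ℝ → ℝ} (hψ : Measurable ψ)
    (hb : ∀ t, |ψ t| ≤ K * (1 + t ^ 2)) :
    ExpRare.{u} fun _ m u a =>
      m * ((∫ t, ψ t ∂(gaussianReal 0 1)) + τ) ≤ ∑ i : Fin m, ψ (inner ℝ (a i) u) := by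
  obtain ⟨C, hC, h⟩ := exists_chernoff.{u} hK hτ
  refine ⟨1, C, one_pos, hC, fun n m _ u hu Ω _ P _ a hlaw hind => ?_⟩
  have := h n m u hu (fun b => ψ (inner ℝ b u)) (by fun_prop) (fun b => hb _) Ω P a hlaw hind
  rwa [integral_comp_inner_stdGaussian hu hψ] at this

theorem expRare_net_deviation {K τ ε : ℝ} (hK : 0 < K) (hτ : 0 < τ) (hε : 0 < ε)
    {h : ℝ → ℝ → ℝ} (hm : Measurable (Function.uncurry h))
    (hb : ∀ g t, |h g t| ≤ K * (1 + t ^ 2)) :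
    ∃ N : ∀ n, Finset (EuclideanSpace ℝ (Fin n)),
      (∀ n, ∀ v ∈ N n, ‖v‖ = 1) ∧ (∀ n (u : EuclideanSpace ℝ (Fin n)), ‖u‖ = 1 →
        ∃ v ∈ N n, ‖u - v‖ ≤ ε) ∧
      ExpRare.{u} fun n m u a => ∃ v ∈ N n,
        m * ((∫ b, h (inner ℝ b u) (inner ℝ b v) ∂(stdGaussian (EuclideanSpace ℝ (Fin n)))) + τ) ≤
          ∑ i : Fin m, h (inner ℝ (a i) u) (inner ℝ (a i) v) := by
  choose N hN1 hN2 hN3 using fun n => exists_sphere_net (E := EuclideanSpace ℝ (Fin n)) hε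
  refine ⟨N, hN1, hN2, ?_⟩
  obtain ⟨C, hC, hch⟩ := exists_chernoff.{u} hK hτ
  set l := Real.log (1 + 2 / ε) with hl
  have hl0 : 0 < l := Real.log_pos (by linarith [show 0 < 2 / ε by positivity])
  -- The net has at most `exp (l * n)` points, and `m > 2 * l / C * n` lets half of the Chernoff
  -- exponent pay for them.
  refine ⟨2 * l / C, C / 2, by positivity, by positivity,
    fun n m hnm u hu Ω _ P _ a hlaw hind => ?_⟩
  have hcard : ((N n).card : ℝ) ≤ Real.exp (C / 2 * m) := by
    refine (hN3 n).trans ?_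
    rw [finrank_euclideanSpace_fin, ← Real.exp_log (show 0 < 1 + 2 / ε by positivity),
      ← Real.exp_nat_mul, Real.exp_le_exp, ← hl]
    have h1 : 2 * l / C * n < m := hnm
    rw [div_mul_eq_mul_div, div_lt_iff₀ hC] at h1
    linarith
  calc P {ω | ∃ v ∈ N n, m * ((∫ b, h (inner ℝ b u) (inner ℝ b v)
          ∂(stdGaussian (EuclideanSpace ℝ (Fin n)))) + τ) ≤
          ∑ i : Fin m, h (inner ℝ (a i ω) u) (inner ℝ (a i ω) v)}
      ≤ P (⋃ v ∈ N n, {ω | m * ((∫ b, h (inner ℝ b u) (inner ℝ b v)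
          ∂(stdGaussian (EuclideanSpace ℝ (Fin n)))) + τ) ≤
          ∑ i : Fin m, h (inner ℝ (a i ω) u) (inner ℝ (a i ω) v)}) := by
        refine measure_mono fun ω hω => ?_
        obtain ⟨v, hv, h⟩ := hω
        exact Set.mem_biUnion hv h
    _ ≤ ∑ v ∈ N n, ENNReal.ofReal (Real.exp (-(C * m))) := by
        refine (measure_biUnion_finset_le _ _).trans (Finset.sum_le_sum fun v hv => ?_)
        refine hch n m v (hN1 n v hv) (fun b => h (inner ℝ b u) (inner ℝ b v)) ?_
          (fun b => hb _ _) Ω P a hlaw hind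
        exact hm.comp (f := fun b : EuclideanSpace ℝ (Fin n) => ((inner ℝ b u : ℝ), (inner ℝ b v : ℝ)))
          (by fun_prop)
    _ = ENNReal.ofReal ((N n).card * Real.exp (-(C * m))) := by
        rw [Finset.sum_const, nsmul_eq_mul, ENNReal.ofReal_mul (by positivity),
          ENNReal.ofReal_natCast]
    _ ≤ _ := by
        refine ENNReal.ofReal_le_ofReal ?_
        calc _ ≤ Real.exp (C / 2 * m) * Real.exp (-(C * m)) := by gcongr
          _ = _ := by rw [← Real.exp_add]; congr 1; ring

/-! ### Passing from the net to the sphere -/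

section Continuity

theorem abs_sq_sub_sq_le {ε : ℝ} (hε : 0 < ε) (s t : ℝ) :
    |s ^ 2 - t ^ 2| ≤ (s - t) ^ 2 / (2 * ε) + ε / 2 * (s + t) ^ 2 := by
  have h : ∀ x y : ℝ, x * y ≤ x ^ 2 / (2 * ε) + ε / 2 * y ^ 2 := fun x y => by
    have : x ^ 2 / (2 * ε) + ε / 2 * y ^ 2 - x * y = (x - ε * y) ^ 2 / (2 * ε) := by
      field_simp; ring
    linarith [show 0 ≤ (x - ε * y) ^ 2 / (2 * ε) by positivity]
  rw [abs_le]
  constructor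
  · have := h (-(s - t)) (s + t)
    rw [neg_sq] at this
    linarith [show s ^ 2 - t ^ 2 = (s - t) * (s + t) by ring]
  · linarith [h (s - t) (s + t), show s ^ 2 - t ^ 2 = (s - t) * (s + t) by ring]

variable {n m : ℕ}

theorem sum_sq_inner_le_mul_norm_sq {a : Fin m → EuclideanSpace ℝ (Fin n)} {S : ℝ}
    (hS : ∀ v, ‖v‖ = 1 → ∑ i, (inner ℝ (a i) v) ^ 2 ≤ S) (w : EuclideanSpace ℝ (Fin n)) :
    ∑ i, (inner ℝ (a i) w) ^ 2 ≤ S * ‖w‖ ^ 2 := by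
  by_cases hw : w = 0
  · simp [hw]
  have hw0 : 0 < ‖w‖ := norm_pos_iff.2 hw
  have := hS ((‖w‖⁻¹ : ℝ) • w) (by rw [norm_smul, norm_inv, norm_norm, inv_mul_cancel₀ hw0.ne'])
  simp only [inner_smul_right, mul_pow, ← Finset.mul_sum] at this
  rwa [inv_pow, inv_mul_le_iff₀ (by positivity), mul_comm] at this

/-- Factor the difference of squares and apply AM–GM with weight `ε`: the part from `v - w` costs `ε
/ 2`, the part from `v + w` costs `2 * ε`. -/
theorem sum_abs_sq_inner_sub_le {a : Fin m → EuclideanSpace ℝ (Fin n)} {S ε : ℝ} (hS0 : 0 ≤ S)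
    (hε : 0 < ε) (hS : ∀ v, ‖v‖ = 1 → ∑ i, (inner ℝ (a i) v) ^ 2 ≤ S)
    {v w : EuclideanSpace ℝ (Fin n)} (hv : ‖v‖ = 1) (hw : ‖w‖ = 1) (hvw : ‖v - w‖ ≤ ε) :
    ∑ i, |(inner ℝ (a i) v) ^ 2 - (inner ℝ (a i) w) ^ 2| ≤ 5 / 2 * ε * S := by
  have h1 := sum_sq_inner_le_mul_norm_sq hS (v - w)
  have h2 := sum_sq_inner_le_mul_norm_sq hS (v + w)
  have h3 : ‖v + w‖ ≤ 2 := (norm_add_le v w).trans (by rw [hv, hw]; norm_num)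
  calc _ ≤ ∑ i, ((inner ℝ (a i) (v - w)) ^ 2 / (2 * ε) + ε / 2 * (inner ℝ (a i) (v + w)) ^ 2) := by
        refine Finset.sum_le_sum fun i _ => ?_
        rw [inner_sub_right, inner_add_right]
        exact abs_sq_sub_sq_le hε _ _
    _ = (∑ i, (inner ℝ (a i) (v - w)) ^ 2) / (2 * ε) +
        ε / 2 * ∑ i, (inner ℝ (a i) (v + w)) ^ 2 := by
        rw [Finset.sum_add_distrib, Finset.sum_div, Finset.mul_sum]
    _ ≤ (S * ε ^ 2) / (2 * ε) + ε / 2 * (S * 2 ^ 2) := by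
        gcongr
        · exact h1.trans (by gcongr)
        · exact h2.trans (by gcongr)
    _ = _ := by field_simp; ring

theorem integral_sq_inner_stdGaussian (w : EuclideanSpace ℝ (Fin n)) :
    Integrable (fun b => (inner ℝ b w) ^ 2) (stdGaussian (EuclideanSpace ℝ (Fin n))) ∧
      ∫ b, (inner ℝ b w) ^ 2 ∂(stdGaussian (EuclideanSpace ℝ (Fin n))) = ‖w‖ ^ 2 := by
  by_cases hw : w = 0
  · simp [hw]
  have hw0 : 0 < ‖w‖ := norm_pos_iff.2 hw
  have hu : ‖(‖w‖⁻¹ : ℝ) • w‖ = 1 := by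
    rw [norm_smul, norm_inv, norm_norm, inv_mul_cancel₀ hw0.ne']
  have e : ∀ b : EuclideanSpace ℝ (Fin n),
      (inner ℝ b w) ^ 2 = ‖w‖ ^ 2 * (inner ℝ b ((‖w‖⁻¹ : ℝ) • w)) ^ 2 := fun b => by
    rw [inner_smul_right]; field_simp
  simp only [e]
  refine ⟨(integrable_comp_inner_stdGaussian hu (integrable_pow_gaussianReal 2)).const_mul _, ?_⟩
  rw [integral_const_mul, integral_comp_inner_stdGaussian hu (f := fun t => t ^ 2) (by fun_prop),
    integral_sq_gaussianReal, mul_one]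

theorem integral_abs_sq_inner_sub_le {ε : ℝ} (hε : 0 < ε)
    {v w : EuclideanSpace ℝ (Fin n)} (hv : ‖v‖ = 1) (hw : ‖w‖ = 1) (hvw : ‖v - w‖ ≤ ε) :
    ∫ b, |(inner ℝ b v) ^ 2 - (inner ℝ b w) ^ 2| ∂(stdGaussian (EuclideanSpace ℝ (Fin n))) ≤
      5 / 2 * ε := by
  have h3 : ‖v + w‖ ≤ 2 := (norm_add_le v w).trans (by rw [hv, hw]; norm_num)
  obtain ⟨i1, e1⟩ := integral_sq_inner_stdGaussian (v - w)
  obtain ⟨i2, e2⟩ := integral_sq_inner_stdGaussian (v + w)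
  calc _ ≤ ∫ b, ((inner ℝ b (v - w)) ^ 2 / (2 * ε) + ε / 2 * (inner ℝ b (v + w)) ^ 2)
        ∂(stdGaussian (EuclideanSpace ℝ (Fin n))) := by
        refine integral_mono ((integral_sq_inner_stdGaussian v).1.sub
          (integral_sq_inner_stdGaussian w).1).abs ((i1.div_const _).add (i2.const_mul _)) fun b => ?_
        simp only [inner_sub_right, inner_add_right]
        exact abs_sq_sub_sq_le hε _ _
    _ = ‖v - w‖ ^ 2 / (2 * ε) + ε / 2 * ‖v + w‖ ^ 2 := by
        rw [integral_add (i1.div_const _) (i2.const_mul _), integral_div, integral_const_mul, e1, e2]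
    _ ≤ ε ^ 2 / (2 * ε) + ε / 2 * 2 ^ 2 := by gcongr
    _ = _ := by field_simp; ring

/-- At a maximizer on the sphere, mesh `1 / 5` gives `max ≤ R + max / 2`. -/
theorem sum_sq_inner_le_two_mul_of_net {a : Fin m → EuclideanSpace ℝ (Fin n)} {R : ℝ}
    {N : Finset (EuclideanSpace ℝ (Fin n))} (hN1 : ∀ v ∈ N, ‖v‖ = 1)
    (hN2 : ∀ u : EuclideanSpace ℝ (Fin n), ‖u‖ = 1 → ∃ v ∈ N, ‖u - v‖ ≤ 1 / 5)
    (hR : ∀ v ∈ N, ∑ i, (inner ℝ (a i) v) ^ 2 ≤ R) {v : EuclideanSpace ℝ (Fin n)} (hv : ‖v‖ = 1) :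
    ∑ i, (inner ℝ (a i) v) ^ 2 ≤ 2 * R := by
  obtain ⟨w, hw, hmax⟩ := (isCompact_sphere (0 : EuclideanSpace ℝ (Fin n)) 1).exists_isMaxOn
    ⟨v, by simpa using hv⟩
    (f := fun v => ∑ i, (inner ℝ (a i) v) ^ 2) (by fun_prop)
  have hw1 : ‖w‖ = 1 := by simpa using hw
  have hS : ∀ v, ‖v‖ = 1 → ∑ i, (inner ℝ (a i) v) ^ 2 ≤ ∑ i, (inner ℝ (a i) w) ^ 2 :=
    fun v hv => hmax (by simpa using hv)
  obtain ⟨w', hw', hd⟩ := hN2 w hw1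
  have h1 := sum_abs_sq_inner_sub_le (Finset.sum_nonneg fun i _ => sq_nonneg _) (by norm_num) hS hw1
    (hN1 w' hw') hd
  have h2 : ∑ i, (inner ℝ (a i) w) ^ 2 - ∑ i, (inner ℝ (a i) w') ^ 2 ≤
      ∑ i, |(inner ℝ (a i) w) ^ 2 - (inner ℝ (a i) w') ^ 2| := by
    rw [← Finset.sum_sub_distrib]
    exact Finset.sum_le_sum fun i _ => le_abs_self _
  linarith [hS v hv, hR w' hw']

end Continuity

/-! ### Deviations uniform over the sphere -/

theorem expRare_sum_sq_inner :
    ExpRare.{u} fun _ m _ a => ∃ v, ‖v‖ = 1 ∧ 4 * (m : ℝ) < ∑ i : Fin m, (inner ℝ (a i) v) ^ 2 := by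
  obtain ⟨N, hN1, hN2, h⟩ := expRare_net_deviation.{u} (K := 1) (τ := 1) (ε := 1 / 5) one_pos one_pos
    (by norm_num) (h := fun _ t => t ^ 2) (by unfold Function.uncurry; fun_prop)
    (fun g t => by rw [abs_of_nonneg (sq_nonneg t)]; linarith)
  refine h.mono fun n m u a _ _ => ?_
  rintro ⟨v, hv, hlt⟩
  by_contra! hcon
  have := sum_sq_inner_le_two_mul_of_net (a := a) (R := 2 * m) (hN1 n) (hN2 n) (fun v hv => ?_) hv
  · linarith
  · have := hcon v hv
    rw [(integral_sq_inner_stdGaussian v).2, hN1 n v hv] at this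
    linarith

theorem expRare_uniform_deviation {K τ : ℝ} (hK : 0 < K) (hτ : 0 < τ) {h : ℝ → ℝ → ℝ}
    (hm : Measurable (Function.uncurry h)) (hb : ∀ g t, |h g t| ≤ K * (1 + t ^ 2))
    (hc : ∀ g s t, |h g s - h g t| ≤ K * |s ^ 2 - t ^ 2|) :
    ExpRare.{u} fun n m u a => ∃ v, ‖v‖ = 1 ∧
      m * ((∫ b, h (inner ℝ b u) (inner ℝ b v) ∂(stdGaussian (EuclideanSpace ℝ (Fin n)))) + τ) <
        ∑ i : Fin m, h (inner ℝ (a i) u) (inner ℝ (a i) v) := by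
  -- Moving to a net point costs `2/5 τ` in the empirical average and `1/10 τ` in the mean; the net
  -- deviation uses the remaining `τ / 2`.
  set ε := τ / (25 * K) with hε
  have hε0 : 0 < ε := by positivity
  obtain ⟨N, hN1, hN2, h1⟩ := expRare_net_deviation.{u} hK (half_pos hτ) hε0 hm hb
  refine (h1.or expRare_sum_sq_inner).mono fun n m u a hm0 hu => ?_
  rintro ⟨v, hv, hlt⟩
  by_contra! hcon
  obtain ⟨hc1, hc2⟩ := hcon
  obtain ⟨w, hw, hd⟩ := hN2 n v hv
  have hw1 := hN1 n w hw
  have e1 := hc1 w hw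
  have e2 := sum_abs_sq_inner_sub_le (by positivity) hε0 hc2 hv hw1 hd
  have e3 := integral_abs_sq_inner_sub_le hε0 hv hw1 hd
  have hint : ∀ v : EuclideanSpace ℝ (Fin n), Integrable
      (fun b => h (inner ℝ b u) (inner ℝ b v)) (stdGaussian (EuclideanSpace ℝ (Fin n))) := fun v =>
    (((integrable_const 1).add (integral_sq_inner_stdGaussian v).1).const_mul K).mono'
      (hm.comp (f := fun b : EuclideanSpace ℝ (Fin n) => ((inner ℝ b u : ℝ), (inner ℝ b v : ℝ)))
          (by fun_prop)).aestronglyMeasurable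
      (ae_of_all _ fun b => hb _ _)
  have e4 : ∑ i : Fin m, h (inner ℝ (a i) u) (inner ℝ (a i) v) -
      ∑ i : Fin m, h (inner ℝ (a i) u) (inner ℝ (a i) w) ≤ K * (5 / 2 * ε * (4 * m)) := by
    rw [← Finset.sum_sub_distrib]
    calc _ ≤ ∑ i, K * |(inner ℝ (a i) v) ^ 2 - (inner ℝ (a i) w) ^ 2| :=
          Finset.sum_le_sum fun i _ => (le_abs_self _).trans (hc _ _ _)
      _ ≤ _ := by rw [← Finset.mul_sum]; gcongr
  have e5 : ∫ b, h (inner ℝ b u) (inner ℝ b w) ∂(stdGaussian (EuclideanSpace ℝ (Fin n))) -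
      ∫ b, h (inner ℝ b u) (inner ℝ b v) ∂(stdGaussian (EuclideanSpace ℝ (Fin n))) ≤
      K * (5 / 2 * ε) := by
    rw [← integral_sub (hint w) (hint v)]
    calc _ ≤ ∫ b, K * |(inner ℝ b v) ^ 2 - (inner ℝ b w) ^ 2|
          ∂(stdGaussian (EuclideanSpace ℝ (Fin n))) := by
          refine integral_mono ((hint w).sub (hint v)) (((integral_sq_inner_stdGaussian v).1.sub
            (integral_sq_inner_stdGaussian w).1).abs.const_mul K) fun b => ?_
          refine (le_abs_self _).trans ((hc _ _ _).trans_eq ?_)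
          rw [abs_sub_comm]
      _ ≤ _ := by rw [integral_const_mul]; gcongr
  have hmpos : (0 : ℝ) < m := by exact_mod_cast hm0
  have e6 := mul_le_mul_of_nonneg_left e5 hmpos.le
  have hKε : K * ε = τ / 25 := by rw [hε]; field_simp
  have e7 : K * (5 / 2 * ε * (4 * m)) = 2 / 5 * τ * m := by linear_combination 10 * m * hKε
  have e8 : m * (K * (5 / 2 * ε)) = τ / 10 * m := by linear_combination 5 / 2 * m * hKε
  rw [e7] at e4
  rw [e8] at e6
  linarith

/-- The function `g ↦ g ^ 2 1{g ^ 2 ≤ T}`. -/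
def truncSq (T g : ℝ) : ℝ := if g ^ 2 ≤ T then g ^ 2 else 0

/-! ### The truncated square and its spectral gap -/

section TruncSq

variable {T : ℝ}

@[fun_prop]
theorem measurable_truncSq (T : ℝ) : Measurable (truncSq T) :=
  Measurable.ite (measurableSet_le (by fun_prop) (by fun_prop)) (by fun_prop) (by fun_prop)

theorem truncSq_nonneg (T g : ℝ) : 0 ≤ truncSq T g := by
  unfold truncSq; split_ifs <;> positivity

theorem truncSq_le (hT : 0 ≤ T) (g : ℝ) : truncSq T g ≤ T := by
  unfold truncSq; split_ifs with h
  · exact h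
  · exact hT

theorem abs_truncSq_le (hT : 0 ≤ T) (g : ℝ) : |truncSq T g| ≤ T := by
  rw [abs_of_nonneg (truncSq_nonneg T g)]; exact truncSq_le hT g

theorem integrable_truncSq_mul_pow (hT : 0 ≤ T) (k : ℕ) :
    Integrable (fun t => truncSq T t * t ^ k) (gaussianReal 0 1) :=
  (integrable_pow_gaussianReal k).bdd_mul (by fun_prop)
    (ae_of_all _ fun t => by simpa using abs_truncSq_le hT t)

/-- Integrate `1{t² ≤ T} (t⁴ - t²) ≥ t⁴ - t² - t⁶ / T`; beyond the truncation `t⁶ / T` dominates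
`t⁴`. -/
theorem two_sub_le_integral_truncSq_gap (hT : 0 < T) :
    2 - 15 / T ≤ ∫ t, truncSq T t * t ^ 2 ∂(gaussianReal 0 1) -
      ∫ t, truncSq T t ∂(gaussianReal 0 1) := by
  have i0 : Integrable (fun t => truncSq T t) (gaussianReal 0 1) := by
    simpa using integrable_truncSq_mul_pow hT.le 0
  have i42 : Integrable (fun t : ℝ => t ^ 4 - t ^ 2) (gaussianReal 0 1) :=
    (integrable_pow_gaussianReal 4).sub (integrable_pow_gaussianReal 2)
  rw [← integral_sub (integrable_truncSq_mul_pow hT.le 2) i0]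
  have e : ∫ t, (t ^ 4 - t ^ 2 - t ^ 6 / T) ∂(gaussianReal 0 1) = 2 - 15 / T := by
    rw [integral_sub i42 ((integrable_pow_gaussianReal 6).div_const T),
      integral_sub (integrable_pow_gaussianReal 4) (integrable_pow_gaussianReal 2), integral_div,
      integral_sq_gaussianReal, integral_pow_four_gaussianReal, integral_pow_six_gaussianReal]
    norm_num
  rw [← e]
  refine integral_mono (i42.sub ((integrable_pow_gaussianReal 6).div_const T))
    ((integrable_truncSq_mul_pow hT.le 2).sub i0) fun t => ?_
  simp only [truncSq]
  split_ifs with h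
  · have : 0 ≤ t ^ 6 / T := by positivity
    nlinarith
  · have : t ^ 4 ≤ t ^ 6 / T := by
      rw [le_div_iff₀ hT]
      calc t ^ 4 * T ≤ t ^ 4 * t ^ 2 := by gcongr; exact (not_le.1 h).le
        _ = _ := by ring
    nlinarith [sq_nonneg t]

variable {n : ℕ}

theorem indepFun_inner_stdGaussian {u r : EuclideanSpace ℝ (Fin n)} (h : inner ℝ u r = 0) :
    IndepFun (fun b => inner ℝ b u) (fun b => inner ℝ b r)
      (stdGaussian (EuclideanSpace ℝ (Fin n))) := by
  have hg := (IsGaussian.hasGaussianLaw_id (μ := stdGaussian (EuclideanSpace ℝ (Fin n)))).map_fun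
    ((innerSL ℝ u).prod (innerSL ℝ r))
  have h1 := HasGaussianLaw.indepFun_of_covariance_eq_zero (X := fun b => inner ℝ u b)
    (Y := fun b => inner ℝ r b) (P := stdGaussian (EuclideanSpace ℝ (Fin n))) hg (by
      rw [← covarianceBilin_apply_eq_cov IsGaussian.memLp_two_id, covarianceBilin_stdGaussian]
      exact h)
  simpa only [real_inner_comm] using h1

theorem integral_inner_stdGaussian (r : EuclideanSpace ℝ (Fin n)) :
    ∫ b, inner ℝ b r ∂(stdGaussian (EuclideanSpace ℝ (Fin n))) = 0 := by
  have := integral_strongDual_stdGaussian (innerSL ℝ r)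
  simpa [real_inner_comm] using this

/-- Split `v` into `⟨v,u⟩ u` and `r ⊥ u`. The marginal along `r` is centred and independent of the
one along `u`, so the cross term vanishes. -/
theorem integral_truncSq_mul_sq_inner (hT : 0 ≤ T) {u v : EuclideanSpace ℝ (Fin n)} (hu : ‖u‖ = 1)
    (hv : ‖v‖ = 1) :
    ∫ b, truncSq T (inner ℝ b u) * (inner ℝ b v) ^ 2 ∂(stdGaussian (EuclideanSpace ℝ (Fin n))) =
      (inner ℝ v u) ^ 2 * ∫ t, truncSq T t * t ^ 2 ∂(gaussianReal 0 1) +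
        (1 - (inner ℝ v u) ^ 2) * ∫ t, truncSq T t ∂(gaussianReal 0 1) := by
  set c : ℝ := inner ℝ v u with hc
  set r := v - c • u with hr
  have hur : inner ℝ u r = 0 := by
    rw [hr, inner_sub_right, inner_smul_right, real_inner_self_eq_norm_sq, hu, real_inner_comm, ← hc]
    ring
  have hr2 : ‖r‖ ^ 2 = 1 - c ^ 2 := by
    rw [hr, norm_sub_sq_real, inner_smul_right, ← hc, norm_smul, hu, hv, Real.norm_eq_abs, mul_one,
      sq_abs]
    ring
  have hind := indepFun_inner_stdGaussian hur
  set γ := stdGaussian (EuclideanSpace ℝ (Fin n))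
  have hYi : Integrable (fun b : EuclideanSpace ℝ (Fin n) => inner ℝ b r) γ := by
    have := (IsGaussian.integrable_id (μ := γ)).inner_const (𝕜 := ℝ) r
    simpa using this
  have i1 : Integrable (fun b => truncSq T (inner ℝ b u) * (inner ℝ b u) ^ 2) γ :=
    integrable_comp_inner_stdGaussian hu (integrable_truncSq_mul_pow hT 2)
  have ind2 : IndepFun (fun b => truncSq T (inner ℝ b u) * inner ℝ b u) (fun b => inner ℝ b r) γ :=
    hind.comp (φ := fun t => truncSq T t * t) (ψ := id) (by fun_prop) (by fun_prop)
  have ind3 : IndepFun (fun b => truncSq T (inner ℝ b u)) (fun b => (inner ℝ b r) ^ 2) γ :=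
    hind.comp (φ := truncSq T) (ψ := fun t => t ^ 2) (by fun_prop) (by fun_prop)
  have i2 : Integrable (fun b => truncSq T (inner ℝ b u) * inner ℝ b u * inner ℝ b r) γ := by
    refine ind2.integrable_mul (integrable_comp_inner_stdGaussian (f := fun t => truncSq T t * t)
      hu ?_) hYi
    simpa using integrable_truncSq_mul_pow hT 1
  have i0 : Integrable (fun b => truncSq T (inner ℝ b u)) γ := by
    refine integrable_comp_inner_stdGaussian (f := truncSq T) hu ?_
    simpa using integrable_truncSq_mul_pow hT 0
  have i3 : Integrable (fun b => truncSq T (inner ℝ b u) * (inner ℝ b r) ^ 2) γ :=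
    ind3.integrable_mul i0 (integral_sq_inner_stdGaussian r).1
  have e2 : ∫ b, truncSq T (inner ℝ b u) * inner ℝ b u * inner ℝ b r ∂γ = 0 := by
    rw [ind2.integral_fun_mul_eq_mul_integral (by fun_prop) (by fun_prop),
      integral_inner_stdGaussian, mul_zero]
  have e3 : ∫ b, truncSq T (inner ℝ b u) * (inner ℝ b r) ^ 2 ∂γ =
      (1 - c ^ 2) * ∫ t, truncSq T t ∂(gaussianReal 0 1) := by
    rw [ind3.integral_fun_mul_eq_mul_integral i0.aestronglyMeasurable (by fun_prop),
      (integral_sq_inner_stdGaussian r).2, hr2,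
      integral_comp_inner_stdGaussian hu (measurable_truncSq T), mul_comm]
  have e1 := integral_comp_inner_stdGaussian (f := fun t => truncSq T t * t ^ 2) hu (by fun_prop)
  have hv' : ∀ b : EuclideanSpace ℝ (Fin n), inner ℝ b v = c * inner ℝ b u + inner ℝ b r := fun b => by
    rw [hr, inner_sub_right, inner_smul_right]; ring
  calc _ = ∫ b, (c ^ 2 * (truncSq T (inner ℝ b u) * (inner ℝ b u) ^ 2) +
        2 * c * (truncSq T (inner ℝ b u) * inner ℝ b u * inner ℝ b r) +
        truncSq T (inner ℝ b u) * (inner ℝ b r) ^ 2) ∂γ := by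
        congr 1; ext b; rw [hv']; ring
    _ = _ := by
        have i12 : Integrable (fun b => c ^ 2 * (truncSq T (inner ℝ b u) * (inner ℝ b u) ^ 2) +
            2 * c * (truncSq T (inner ℝ b u) * inner ℝ b u * inner ℝ b r)) γ :=
          (i1.const_mul _).add (i2.const_mul _)
        rw [integral_add i12 i3,
          integral_add (i1.const_mul _) (i2.const_mul _), integral_const_mul, integral_const_mul,
          e1, e2, e3]
        ring

end TruncSq

/-! ### The rare events used in the proof -/

section RareEvents

theorem expRare_card {p : ℝ → Prop} [DecidablePred p] (hp : MeasurableSet {t | p t}) {q : ℝ}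
    (hq : (gaussianReal 0 1).real {t | p t} < q) :
    ExpRare.{u} fun _ m u a =>
      m * q ≤ ((Finset.univ.filter fun i : Fin m => p (inner ℝ (a i) u)).card : ℝ) := by
  have h := expRare_mean_deviation.{u} (K := 1) (τ := q - (gaussianReal 0 1).real {t | p t}) one_pos
    (sub_pos.2 hq) (ψ := fun t => if p t then 1 else 0)
    (Measurable.ite hp measurable_const measurable_const) (fun t => by
      split_ifs <;> simp <;> positivity)
  have e : ∫ t, (if p t then (1 : ℝ) else 0) ∂(gaussianReal 0 1) =
      (gaussianReal 0 1).real {t | p t} := by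
    rw [← integral_indicator_one hp]
    congr 1
    ext t
    simp [Set.indicator_apply]
  rw [e] at h
  refine h.mono fun n m u a _ _ hB => ?_
  rw [Finset.sum_boole]
  simpa using hB

theorem expRare_truncSq_lower {T τ : ℝ} (hT : 0 < T) (hτ : 0 < τ) :
    ExpRare.{u} fun _ m u a => ∑ i : Fin m, truncSq T (inner ℝ (a i) u) * (inner ℝ (a i) u) ^ 2 ≤
      m * ((∫ t, truncSq T t * t ^ 2 ∂(gaussianReal 0 1)) - τ) := by
  have h := expRare_mean_deviation.{u} (K := T) hT hτ (ψ := fun t => -(truncSq T t * t ^ 2))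
    (by fun_prop) (fun t => by
      rw [abs_neg, abs_mul, abs_of_nonneg (sq_nonneg t)]
      exact mul_le_mul (abs_truncSq_le hT.le t) (by linarith) (by positivity) hT.le)
  refine h.mono fun n m u a _ _ hB => ?_
  rw [integral_neg, Finset.sum_neg_distrib]
  linarith

theorem expRare_truncSq_upper {T τ : ℝ} (hT : 0 < T) (hτ : 0 < τ) :
    ExpRare.{u} fun _ m u a => ∃ v, ‖v‖ = 1 ∧
      m * ((inner ℝ v u) ^ 2 * ∫ t, truncSq T t * t ^ 2 ∂(gaussianReal 0 1) +
        (1 - (inner ℝ v u) ^ 2) * ∫ t, truncSq T t ∂(gaussianReal 0 1) + τ) <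
        ∑ i : Fin m, truncSq T (inner ℝ (a i) u) * (inner ℝ (a i) v) ^ 2 := by
  have h := expRare_uniform_deviation.{u} hT hτ (h := fun g t => truncSq T g * t ^ 2)
    (by unfold Function.uncurry; fun_prop)
    (fun g t => by
      rw [abs_mul, abs_of_nonneg (sq_nonneg t)]
      exact mul_le_mul (abs_truncSq_le hT.le g) (by linarith) (by positivity) hT.le)
    (fun g s t => by
      rw [← mul_sub, abs_mul]
      exact mul_le_mul_of_nonneg_right (abs_truncSq_le hT.le g) (abs_nonneg _))
  refine h.mono fun n m u a _ hu hB => ?_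
  obtain ⟨v, hv, hlt⟩ := hB
  refine ⟨v, hv, ?_⟩
  rwa [integral_truncSq_mul_sq_inner hT.le hu hv]

/-- The excess over `L` is at most `t⁴ / L`, and the fourth moment is 3. It controls sums over a
small index set that may depend on the rows. -/
theorem expRare_excess {L τ : ℝ} (hL : 0 < L) (hτ : 0 < τ) :
    ExpRare.{u} fun _ m _ a => ∃ v, ‖v‖ = 1 ∧
      m * (3 / L + τ) < ∑ i : Fin m, max ((inner ℝ (a i) v) ^ 2 - L) 0 := by
  have hmax : ∀ t : ℝ, |max (t ^ 2 - L) 0| ≤ t ^ 2 := fun t => by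
    rw [abs_of_nonneg (le_max_right _ _)]
    exact max_le (by linarith) (sq_nonneg t)
  have h := expRare_uniform_deviation.{u} one_pos hτ (h := fun _ t => max (t ^ 2 - L) 0)
    (by unfold Function.uncurry; fun_prop)
    (fun g t => (hmax t).trans (by linarith))
    (fun g s t => by
      refine (abs_max_sub_max_le_abs _ _ _).trans ?_
      rw [sub_sub_sub_cancel_right, one_mul])
  refine h.mono fun n m u a _ hu hB => ?_
  obtain ⟨v, hv, hlt⟩ := hB
  refine ⟨v, hv, lt_of_le_of_lt ?_ hlt⟩
  gcongr
  rw [integral_comp_inner_stdGaussian hv (f := fun t => max (t ^ 2 - L) 0) (by fun_prop),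
    ← integral_pow_four_gaussianReal, ← integral_div]
  refine integral_mono ((integrable_pow_gaussianReal 2).mono' (by fun_prop) (ae_of_all _ hmax))
    ((integrable_pow_gaussianReal 4).div_const L) fun t => ?_
  refine max_le ?_ (by positivity)
  rw [le_div_iff₀ hL]
  nlinarith [sq_nonneg (t ^ 2 - L), sq_nonneg t]

end RareEvents

/-! ### Robustness of the sample median -/

section SampleMedian

theorem sampleMedian_mem_Icc {m : ℕ} (hm : 0 < m) {y : Fin m → ℝ} {lo hi : ℝ}
    (hlo : ∀ t < lo, ((Finset.univ.filter fun i => y i ≤ t).card : ℝ) < m / 2)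
    (hhi : (m / 2 : ℝ) ≤ (Finset.univ.filter fun i => y i ≤ hi).card) :
    sampleMedian y ∈ Set.Icc lo hi := by
  have hm' : (0 : ℝ) < m := by exact_mod_cast hm
  have h1 : ∀ t ∈ {t : ℝ | 1 / 2 ≤ empiricalCDF y t}, lo ≤ t := fun t ht => by
    by_contra! hlt
    have h2 : 1 / 2 ≤ ((Finset.univ.filter fun i => y i ≤ t).card : ℝ) / m := ht
    rw [le_div_iff₀ hm'] at h2
    linarith [hlo t hlt]
  have h2 : hi ∈ {t : ℝ | 1 / 2 ≤ empiricalCDF y t} := by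
    change 1 / 2 ≤ ((Finset.univ.filter fun i => y i ≤ hi).card : ℝ) / m
    rw [le_div_iff₀ hm']
    linarith
  exact ⟨le_csInf ⟨hi, h2⟩ h1, csInf_le ⟨lo, h1⟩ h2⟩

/-- The sample median is robust to noise and to a small fraction of outliers. -/
theorem sampleMedian_mem_Icc_of_noise {m : ℕ} (hm : 0 < m) {y₀ w η : Fin m → ℝ} {lo hi c s : ℝ}
    (hw : ∀ i, |w i| ≤ c) (hη : ((Finset.univ.filter fun i => η i ≠ 0).card : ℝ) ≤ s * m)
    (hlo : ((Finset.univ.filter fun i => y₀ i ≤ lo).card : ℝ) < m * (1 / 2 - s))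
    (hhi : ((Finset.univ.filter fun i => ¬ y₀ i ≤ hi).card : ℝ) < m * (1 / 2 - s)) :
    sampleMedian (fun i => y₀ i + w i + η i) ∈ Set.Icc (lo - c) (hi + c) := by
  refine sampleMedian_mem_Icc hm (fun t ht => ?_) ?_
  · have hsub : (Finset.univ.filter fun i => y₀ i + w i + η i ≤ t) ⊆
        (Finset.univ.filter fun i => y₀ i ≤ lo) ∪ (Finset.univ.filter fun i => η i ≠ 0) := by
      intro i hi
      simp only [Finset.mem_filter, Finset.mem_univ, true_and, Finset.mem_union] at hi ⊢
      by_contra! hcon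
      rw [hcon.2, add_zero] at hi
      linarith [(abs_le.1 (hw i)).1, hcon.1]
    have h1 : ((Finset.univ.filter fun i => y₀ i + w i + η i ≤ t).card : ℝ) ≤
        (Finset.univ.filter fun i => y₀ i ≤ lo).card + (Finset.univ.filter fun i => η i ≠ 0).card := by
      exact_mod_cast (Finset.card_le_card hsub).trans (Finset.card_union_le _ _)
    linarith
  · have hsub : (Finset.univ : Finset (Fin m)) ⊆
        (Finset.univ.filter fun i => y₀ i + w i + η i ≤ hi + c) ∪
        ((Finset.univ.filter fun i => ¬ y₀ i ≤ hi) ∪ (Finset.univ.filter fun i => η i ≠ 0)) := by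
      intro i _
      simp only [Finset.mem_filter, Finset.mem_univ, true_and, Finset.mem_union]
      by_contra! hcon
      obtain ⟨h1, h2, h3⟩ := hcon
      rw [h3, add_zero] at h1
      linarith [(abs_le.1 (hw i)).2]
    have h1 : (m : ℝ) ≤ (Finset.univ.filter fun i => y₀ i + w i + η i ≤ hi + c).card +
        ((Finset.univ.filter fun i => ¬ y₀ i ≤ hi).card +
          (Finset.univ.filter fun i => η i ≠ 0).card) := by
      have := (Finset.card_le_card hsub).trans ((Finset.card_union_le _ _).trans
        (Nat.add_le_add_left (Finset.card_union_le _ _) _))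
      rw [Finset.card_univ, Fintype.card_fin] at this
      exact_mod_cast this
    linarith

end SampleMedian

/-! ### The variational property of a leading eigenvector -/

section LeadingEigenvector

variable {n m : ℕ}

theorem isHermitian_initMatrix (κ α : ℝ) (a : Fin m → EuclideanSpace ℝ (Fin n)) (y : Fin m → ℝ) :
    (initMatrix κ α a y).IsHermitian := by
  unfold initMatrix Matrix.IsHermitian
  rw [Matrix.conjTranspose_smul, Matrix.conjTranspose_sum]
  congr 1
  refine Finset.sum_congr rfl fun i _ => ?_
  split_ifs
  · ext j k
    simp [Matrix.vecMulVec_apply, mul_comm]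
  · simp

theorem inner_toEuclideanLin_vecMulVec (b v : EuclideanSpace ℝ (Fin n)) :
    inner ℝ (Matrix.toEuclideanLin (Matrix.vecMulVec b b) v) v = (inner ℝ b v) ^ 2 := by
  have h : Matrix.toEuclideanLin (Matrix.vecMulVec b b) v = (inner ℝ b v : ℝ) • b := by
    ext j
    simp [Matrix.toLpLin_apply, Matrix.vecMulVec_mulVec, PiLp.inner_apply, dotProduct,
      mul_comm]
  rw [h, real_inner_smul_left, sq]

theorem inner_initMatrix (κ α : ℝ) (a : Fin m → EuclideanSpace ℝ (Fin n)) (y : Fin m → ℝ)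
    (v : EuclideanSpace ℝ (Fin n)) :
    inner ℝ (Matrix.toEuclideanLin (initMatrix κ α a y) v) v =
      (1 / m : ℝ) * ∑ i, (if |y i| ≤ α ^ 2 * initScale κ y ^ 2 then y i else 0) *
        (inner ℝ (a i) v) ^ 2 := by
  unfold initMatrix
  simp only [map_smul, map_sum, LinearMap.smul_apply, LinearMap.sum_apply, real_inner_smul_left,
    sum_inner]
  congr 1
  refine Finset.sum_congr rfl fun i _ => ?_
  split_ifs
  · rw [map_smul, LinearMap.smul_apply, real_inner_smul_left, inner_toEuclideanLin_vecMulVec]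
  · simp

/-- In finite dimension the supremum of the Rayleigh quotient is an eigenvalue, hence at most `l`.
-/
theorem IsLeadingEigenvector.inner_le {Y : Matrix (Fin n) (Fin n) ℝ} (hY : Y.IsHermitian)
    {v : EuclideanSpace ℝ (Fin n)} (hv : IsLeadingEigenvector Y v) {u : EuclideanSpace ℝ (Fin n)}
    (hu : ‖u‖ = 1) :
    inner ℝ (Matrix.toEuclideanLin Y u) u ≤ inner ℝ (Matrix.toEuclideanLin Y v) v := by
  obtain ⟨hv1, l, hl, hmax⟩ := hv
  have hu0 : u ≠ 0 := fun h => by rw [h, norm_zero] at hu; exact zero_ne_one hu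
  have : Nontrivial (EuclideanSpace ℝ (Fin n)) := ⟨u, 0, hu0⟩
  set T := Matrix.toEuclideanLin Y
  have hS : T.IsSymmetric := Matrix.isSymmetric_toEuclideanLin_iff.2 hY
  have h1 := hmax _ hS.hasEigenvalue_iSup_of_finiteDimensional
  have hbdd : BddAbove (Set.range fun x : {x : EuclideanSpace ℝ (Fin n) // x ≠ 0} =>
      (RCLike.re (inner ℝ (T x) (x : EuclideanSpace ℝ (Fin n))) / ‖(x : EuclideanSpace ℝ (Fin n))‖ ^ 2 : ℝ)) := by
    refine ⟨‖LinearMap.toContinuousLinearMap T‖, ?_⟩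
    rintro _ ⟨⟨x, hx⟩, rfl⟩
    have hx0 : 0 < ‖x‖ := norm_pos_iff.2 hx
    simp only [RCLike.re_to_real]
    rw [div_le_iff₀ (by positivity)]
    calc inner ℝ (T x) x ≤ ‖T x‖ * ‖x‖ := real_inner_le_norm _ _
      _ ≤ (‖LinearMap.toContinuousLinearMap T‖ * ‖x‖) * ‖x‖ := by
        gcongr
        exact (LinearMap.toContinuousLinearMap T).le_opNorm x
      _ = _ := by ring
  have h2 := le_ciSup hbdd ⟨u, hu0⟩
  simp only [RCLike.re_to_real, hu, one_pow, div_one] at h2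
  rw [hl, real_inner_smul_left, real_inner_self_eq_norm_sq, hv1, one_pow, mul_one]
  exact h2.trans h1

end LeadingEigenvector

/-! ### Perturbation of the weights and of the output -/

section Perturbation

/-- Away from the window around `T`, the noisy sample and the clean one fall on the same side of
their respective thresholds. -/
theorem abs_truncated_sub_truncSq_le {T T' e c : ℝ} (hTe : |T' - T| ≤ e)
    {ε : ℝ} (hce : e + c ≤ ε) (hc : 0 ≤ c) {g y : ℝ} (hy : |y - g ^ 2| ≤ c)
    (hg : ¬ |g ^ 2 - T| ≤ ε) :
    |(if |y| ≤ T' then y else 0) - truncSq T g| ≤ c := by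
  obtain ⟨hT1, hT2⟩ := abs_le.1 hTe
  obtain ⟨hy1, hy2⟩ := abs_le.1 hy
  have he : 0 ≤ e := (abs_nonneg _).trans hTe
  have hg2 := sq_nonneg g
  rcases lt_abs.1 (not_le.1 hg) with h | h
  · have h1 : ¬ |y| ≤ T' := fun h' => by linarith [le_abs_self y]
    have h2 : ¬ g ^ 2 ≤ T := fun h' => by linarith
    rw [truncSq, if_neg h1, if_neg h2, sub_zero, abs_zero]
    exact hc
  · have h1 : |y| ≤ T' := abs_le.2 ⟨by linarith, by linarith⟩
    have h2 : g ^ 2 ≤ T := by linarith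
    rwa [truncSq, if_pos h1, if_pos h2]

theorem abs_truncated_sub_truncSq_le_const {T T' e : ℝ} (hT : 0 ≤ T) (hTe : |T' - T| ≤ e)
    (he : e ≤ 1) (g y : ℝ) : |(if |y| ≤ T' then y else 0) - truncSq T g| ≤ 2 * T + 1 := by
  have h1 := abs_truncSq_le hT g
  have h2 : |if |y| ≤ T' then y else 0| ≤ T + 1 := by
    split_ifs with h
    · linarith [(abs_le.1 hTe).2]
    · simp; linarith
  have h3 := norm_sub_le (if |y| ≤ T' then y else 0) (truncSq T g)
  simp only [Real.norm_eq_abs] at h3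
  linarith

/-- On the exceptional set `t² ≤ L + max (t² - L) 0`: the first term uses its cardinality, the
second is summed over all indices. -/
theorem abs_sum_sub_sum_mul_sq_le {m : ℕ} {F f t : Fin m → ℝ} {c K L N : ℝ} (hc : 0 ≤ c)
    (hK : 0 ≤ K) (hL : 0 ≤ L) {s : Finset (Fin m)} (hs : (s.card : ℝ) ≤ N)
    (hgood : ∀ i ∉ s, |F i - f i| ≤ c) (hbad : ∀ i, |F i - f i| ≤ K) :
    |∑ i, F i * t i ^ 2 - ∑ i, f i * t i ^ 2| ≤
      c * ∑ i, t i ^ 2 + K * (L * N + ∑ i, max (t i ^ 2 - L) 0) := by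
  classical
  have hpt : ∀ i, |F i * t i ^ 2 - f i * t i ^ 2| ≤
      c * t i ^ 2 + K * (L * (if i ∈ s then 1 else 0) + max (t i ^ 2 - L) 0) := fun i => by
    rw [← sub_mul, abs_mul, abs_of_nonneg (sq_nonneg (t i))]
    have hm1 := le_max_left (t i ^ 2 - L) 0
    have hm2 := le_max_right (t i ^ 2 - L) 0
    have ht := sq_nonneg (t i)
    split_ifs with h
    · have h1 := mul_le_mul_of_nonneg_right (hbad i) ht
      have h2 : K * t i ^ 2 ≤ K * (L * 1 + max (t i ^ 2 - L) 0) :=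
        mul_le_mul_of_nonneg_left (by linarith) hK
      have := mul_nonneg hc ht
      linarith
    · have h1 := mul_le_mul_of_nonneg_right (hgood i h) ht
      have := mul_nonneg hK hm2
      linarith
  calc _ ≤ ∑ i, |F i * t i ^ 2 - f i * t i ^ 2| := by
        rw [← Finset.sum_sub_distrib]; exact Finset.abs_sum_le_sum_abs _ _
    _ ≤ ∑ i, (c * t i ^ 2 + K * (L * (if i ∈ s then 1 else 0) + max (t i ^ 2 - L) 0)) :=
        Finset.sum_le_sum fun i _ => hpt i
    _ = c * ∑ i, t i ^ 2 + K * (L * s.card + ∑ i, max (t i ^ 2 - L) 0) := by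
        rw [Finset.sum_add_distrib, ← Finset.mul_sum, ← Finset.mul_sum, Finset.sum_add_distrib,
          ← Finset.mul_sum]
        simp
    _ ≤ _ := by gcongr

/-- With the better sign, `‖v ∓ u‖² = 2 - 2 |⟨v,u⟩| ≤ 2 (1 - ⟨v,u⟩²)`. -/
theorem signDist_smul_smul_le {n : ℕ} {u v : EuclideanSpace ℝ (Fin n)} (hu : ‖u‖ = 1)
    (hv : ‖v‖ = 1) {l r ξ : ℝ} (hr : 0 ≤ r) (h : 1 - (inner ℝ v u) ^ 2 ≤ ξ) :
    signDist (l • v) (r • u) ≤ |l - r| + r * √(2 * ξ) := by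
  have hc := abs_real_inner_le_norm v u
  rw [hu, hv, one_mul] at hc
  obtain ⟨hc1, hc2⟩ := abs_le.1 hc
  unfold signDist
  rcases le_total 0 (inner ℝ v u) with h0 | h0
  · refine (min_le_right _ _).trans ?_
    have e : l • v - r • u = (l - r) • v + r • (v - u) := by module
    have h2 : ‖v - u‖ ≤ √(2 * ξ) := by
      refine Real.le_sqrt_of_sq_le ?_
      rw [norm_sub_sq_real, hu, hv]
      nlinarith
    rw [e]
    refine (norm_add_le _ _).trans ?_
    rw [norm_smul, norm_smul, hv, Real.norm_eq_abs, Real.norm_eq_abs, mul_one, abs_of_nonneg hr]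
    gcongr
  · refine (min_le_left _ _).trans ?_
    have e : l • v + r • u = (l - r) • v + r • (v + u) := by module
    have h2 : ‖v + u‖ ≤ √(2 * ξ) := by
      refine Real.le_sqrt_of_sq_le ?_
      rw [norm_add_sq_real, hu, hv]
      nlinarith
    rw [e]
    refine (norm_add_le _ _).trans ?_
    rw [norm_smul, norm_smul, hv, Real.norm_eq_abs, Real.norm_eq_abs, mul_one, abs_of_nonneg hr]
    gcongr

end Perturbation

/-! ### The deterministic estimate on the good event -/

section Deterministic

variable {n m : ℕ}

/-- Compare the values at `u` and `v`: replacing `F` by `f` costs `p` at each, concentration costs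
`τ` at each, and what remains is the gap times `1 - ⟨v,u⟩²`. -/
theorem one_sub_sq_inner_le_of_regular (hm : 0 < m) {a : Fin m → EuclideanSpace ℝ (Fin n)}
    {F f : Fin m → ℝ} {u v : EuclideanSpace ℝ (Fin n)} (hu : ‖u‖ = 1) (hv : ‖v‖ = 1)
    (hlead : ∑ i, F i * (inner ℝ (a i) u) ^ 2 ≤ ∑ i, F i * (inner ℝ (a i) v) ^ 2)
    {A B τ p ξ : ℝ} (hAB : 0 < A - B)
    (hpert : ∀ v, ‖v‖ = 1 →
      |∑ i, F i * (inner ℝ (a i) v) ^ 2 - ∑ i, f i * (inner ℝ (a i) v) ^ 2| ≤ m * p)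
    (hup : ∑ i, f i * (inner ℝ (a i) v) ^ 2 ≤
      m * ((inner ℝ v u) ^ 2 * A + (1 - (inner ℝ v u) ^ 2) * B + τ))
    (hlow : m * (A - τ) ≤ ∑ i, f i * (inner ℝ (a i) u) ^ 2)
    (hξ : 2 * p + 2 * τ ≤ (A - B) * ξ) : 1 - (inner ℝ v u) ^ 2 ≤ ξ := by
  have hm' : (0 : ℝ) < m := by exact_mod_cast hm
  have h1 := (abs_le.1 (hpert u hu)).1
  have h2 := (abs_le.1 (hpert v hv)).2
  have h3 : m * ((A - B) * (1 - (inner ℝ v u) ^ 2)) ≤ m * ((A - B) * ξ) := by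
    have := mul_le_mul_of_nonneg_left hξ hm'.le
    linarith
  exact le_of_mul_le_mul_left (le_of_mul_le_mul_left h3 hm') hAB

/-- Here `ε + c` is the relative error of the median and `e` the resulting error of the threshold.
The window of half-width `ε'` around `T` holds at most a fraction `β` of the samples, and `ξ` is the
squared-sine error of the direction. -/
theorem signDist_le_of_regular (hm : 0 < m) {a : Fin m → EuclideanSpace ℝ (Fin n)}
    {x u : EuclideanSpace ℝ (Fin n)} (hx : x ≠ 0) (hu : ‖u‖ = 1) (hxu : x = ‖x‖ • u)
    {w η : Fin m → ℝ} {κ α θ T ε c s e ε' β L M τ A B ξ δ : ℝ} (hκ : 0 < κ)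
    (hT : T = α ^ 2 * θ / κ) (hT0 : 0 ≤ T) (hc : 0 ≤ c) (hL : 0 ≤ L) (hθ : ε + c ≤ θ)
    (hw : ∀ i, |w i| ≤ c * ‖x‖ ^ 2)
    (hη : ((Finset.univ.filter fun i => η i ≠ 0).card : ℝ) ≤ s * m)
    (hlo : ((Finset.univ.filter fun i => (inner ℝ (a i) u) ^ 2 ≤ θ - ε).card : ℝ) <
      m * (1 / 2 - s))
    (hhi : ((Finset.univ.filter fun i => ¬ (inner ℝ (a i) u) ^ 2 ≤ θ + ε).card : ℝ) <
      m * (1 / 2 - s))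
    (hedge : ((Finset.univ.filter fun i => |(inner ℝ (a i) u) ^ 2 - T| ≤ ε').card : ℝ) ≤ m * β)
    (hsq : ∀ v, ‖v‖ = 1 → ∑ i, (inner ℝ (a i) v) ^ 2 ≤ 4 * m)
    (hex : ∀ v, ‖v‖ = 1 → ∑ i, max ((inner ℝ (a i) v) ^ 2 - L) 0 ≤ m * M)
    (hup : ∀ v, ‖v‖ = 1 → ∑ i, truncSq T (inner ℝ (a i) u) * (inner ℝ (a i) v) ^ 2 ≤
      m * ((inner ℝ v u) ^ 2 * A + (1 - (inner ℝ v u) ^ 2) * B + τ))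
    (hlow : m * (A - τ) ≤ ∑ i, truncSq T (inner ℝ (a i) u) * (inner ℝ (a i) u) ^ 2)
    (he : α ^ 2 / κ * (ε + c) ≤ e) (he1 : e ≤ 1) (hce : e + c ≤ ε') (hAB : 0 < A - B)
    (hξ : 2 * (4 * c + (2 * T + 1) * (L * (β + s) + M)) + 2 * τ ≤ (A - B) * ξ)
    (hδ : ∀ h, |h| ≤ ε + c → |√((θ + h) / κ) - 1| + √(2 * ξ) ≤ δ)
    {z : EuclideanSpace ℝ (Fin n)} (hz : IsSpectralInit κ α a (measurements a x w η) z) :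
    signDist z x ≤ δ * ‖x‖ := by
  classical
  obtain ⟨v, hv, rfl⟩ := hz
  set r := ‖x‖ with hr
  have hr0 : 0 < r := norm_pos_iff.2 hx
  have hr2 : 0 < r ^ 2 := by positivity
  set y := measurements a x w η with hy
  have hax : ∀ i, (inner ℝ (a i) x) ^ 2 = r ^ 2 * (inner ℝ (a i) u) ^ 2 := fun i => by
    rw [hxu, inner_smul_right, mul_pow]
  have hmed : sampleMedian y ∈ Set.Icc (r ^ 2 * (θ - ε) - c * r ^ 2) (r ^ 2 * (θ + ε) + c * r ^ 2) := by
    refine sampleMedian_mem_Icc_of_noise hm hw hη ?_ ?_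
    · simpa only [hax, mul_le_mul_iff_right₀ hr2] using hlo
    · simpa only [hax, mul_le_mul_iff_right₀ hr2] using hhi
  set h := sampleMedian y / r ^ 2 - θ with hh
  have hmedh : sampleMedian y = r ^ 2 * (θ + h) := by rw [hh]; field_simp; ring
  have hhb : |h| ≤ ε + c := by
    rw [hmedh] at hmed
    rw [abs_le]
    constructor
    · have : r ^ 2 * (-(ε + c)) ≤ r ^ 2 * h := by linarith [hmed.1]
      exact le_of_mul_le_mul_left this hr2
    · have : r ^ 2 * h ≤ r ^ 2 * (ε + c) := by linarith [hmed.2]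
      exact le_of_mul_le_mul_left this hr2
  have hθh : 0 ≤ (θ + h) / κ := div_nonneg (by linarith [(abs_le.1 hhb).1]) hκ.le
  have hscale : initScale κ y = r * √((θ + h) / κ) := by
    rw [initScale, hmedh, mul_div_assoc, Real.sqrt_mul hr2.le, Real.sqrt_sq hr0.le]
  set T' := α ^ 2 * ((θ + h) / κ) with hT'
  have hTT' : |T' - T| ≤ e := by
    have : T' - T = α ^ 2 / κ * h := by rw [hT', hT]; ring
    rw [this, abs_mul, abs_of_nonneg (by positivity)]
    exact (mul_le_mul_of_nonneg_left hhb (by positivity)).trans he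
  have hthr : α ^ 2 * initScale κ y ^ 2 = r ^ 2 * T' := by
    rw [hscale, mul_pow, Real.sq_sqrt hθh, hT']; ring
  set Y : Fin m → ℝ := fun i => y i / r ^ 2 with hY
  set F : Fin m → ℝ := fun i => if |Y i| ≤ T' then Y i else 0 with hF
  have hFy : ∀ i, (if |y i| ≤ α ^ 2 * initScale κ y ^ 2 then y i else 0) = r ^ 2 * F i := fun i => by
    have hyi : y i = r ^ 2 * Y i := by rw [hY]; field_simp
    rw [hthr, hyi, abs_mul, abs_of_pos hr2, hF]
    simp only [mul_le_mul_iff_right₀ hr2, mul_ite, mul_zero]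
  have hlead : ∑ i, F i * (inner ℝ (a i) u) ^ 2 ≤ ∑ i, F i * (inner ℝ (a i) v) ^ 2 := by
    have h1 := hv.inner_le (isHermitian_initMatrix κ α a y) hu
    rw [inner_initMatrix, inner_initMatrix] at h1
    simp only [hFy, mul_assoc, ← Finset.mul_sum] at h1
    have hm' : (0 : ℝ) < 1 / m := by
      have : (0 : ℝ) < m := by exact_mod_cast hm
      positivity
    exact le_of_mul_le_mul_left (le_of_mul_le_mul_left h1 hm') hr2
  set S := (Finset.univ.filter fun i => η i ≠ 0) ∪
    (Finset.univ.filter fun i => |(inner ℝ (a i) u) ^ 2 - T| ≤ ε') with hS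
  have hScard : (S.card : ℝ) ≤ m * (β + s) := by
    have : (S.card : ℝ) ≤ (Finset.univ.filter fun i => η i ≠ 0).card +
        (Finset.univ.filter fun i => |(inner ℝ (a i) u) ^ 2 - T| ≤ ε').card := by
      exact_mod_cast Finset.card_union_le _ _
    linarith
  have hgood : ∀ i ∉ S, |F i - truncSq T (inner ℝ (a i) u)| ≤ c := fun i hi => by
    simp only [hS, Finset.mem_union, Finset.mem_filter, Finset.mem_univ, true_and, not_or,
      not_not] at hi
    refine abs_truncated_sub_truncSq_le hTT' hce hc ?_ hi.2
    have e1 : Y i - (inner ℝ (a i) u) ^ 2 = w i / r ^ 2 := by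
      simp only [hY, hy, measurements, hax, hi.1]
      field_simp
      ring
    rw [e1, abs_div, abs_of_pos hr2, div_le_iff₀ hr2]
    exact hw i
  have hbad : ∀ i, |F i - truncSq T (inner ℝ (a i) u)| ≤ 2 * T + 1 := fun i =>
    abs_truncated_sub_truncSq_le_const hT0 hTT' he1 _ _
  have hpert : ∀ v, ‖v‖ = 1 → |∑ i, F i * (inner ℝ (a i) v) ^ 2 -
      ∑ i, truncSq T (inner ℝ (a i) u) * (inner ℝ (a i) v) ^ 2| ≤
      m * (4 * c + (2 * T + 1) * (L * (β + s) + M)) := fun v hv => by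
    refine (abs_sum_sub_sum_mul_sq_le hc (by linarith) hL hScard hgood hbad).trans ?_
    have h1 := mul_le_mul_of_nonneg_left (hsq v hv) hc
    have h2 := mul_le_mul_of_nonneg_left (hex v hv) (show 0 ≤ 2 * T + 1 by linarith)
    linarith
  have hfin := one_sub_sq_inner_le_of_regular hm hu hv.1 hlead hAB hpert (hup v hv.1) hlow hξ
  have hdist := signDist_smul_smul_le hu hv.1 (l := initScale κ y) hr0.le hfin
  rw [← hxu] at hdist
  refine hdist.trans ?_
  have e2 : |initScale κ y - r| = r * |√((θ + h) / κ) - 1| := by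
    rw [hscale, ← mul_sub_one, abs_mul, abs_of_pos hr0]
  rw [e2, ← mul_add, mul_comm δ]
  exact mul_le_mul_of_nonneg_left (hδ h hhb) hr0.le

theorem signDist_le_of_signal_eq_zero (hm : 0 < m) {a : Fin m → EuclideanSpace ℝ (Fin n)}
    {w η : Fin m → ℝ} {κ α s : ℝ} (hs : s < 1 / 2) (hw : ∀ i, |w i| ≤ 0)
    (hη : ((Finset.univ.filter fun i => η i ≠ 0).card : ℝ) ≤ s * m)
    {z : EuclideanSpace ℝ (Fin n)} (hz : IsSpectralInit κ α a (measurements a 0 w η) z) :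
    signDist z 0 ≤ 0 := by
  obtain ⟨v, hv, rfl⟩ := hz
  have hm' : (0 : ℝ) < m := by exact_mod_cast hm
  have hpos : 0 < m * (1 / 2 - s) := mul_pos hm' (by linarith)
  have hmed : sampleMedian (measurements a 0 w η) = 0 := by
    have hle : ∀ ε > 0, |sampleMedian (measurements a 0 w η)| ≤ ε := fun ε hε => by
      -- The level must be negative: at `lo = 0` all the clean samples would be counted.
      have := sampleMedian_mem_Icc_of_noise hm (y₀ := fun i => (inner ℝ (a i) 0) ^ 2) (lo := -ε)
        (hi := ε) hw hη
        (by simpa [hε.not_ge, not_le.2 (neg_lt_zero.2 hε)] using hpos)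
        (by simpa [hε.le, hε.not_gt] using hpos)
      rw [sub_zero, add_zero] at this
      exact abs_le.2 this
    exact abs_nonpos_iff.1 (le_of_forall_gt_imp_ge_of_dense hle)
  simp [signDist, initScale, hmed]

end Deterministic

/-! ### Choice of the constants and conclusion -/

theorem exists_constants_signDist_le (α : ℝ) (hα : 3 ≤ α) (κ δ : ℝ)
    (hκδ : (κ = chiSqMedian ∧ 0 < δ) ∨ (κ = 0.455 ∧ |√(chiSqMedian / κ) - 1| < δ)) :
    ∃ c s c₀ C : ℝ, 0 < c ∧ 0 < s ∧ 0 < c₀ ∧ 0 < C ∧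
      ∀ (n m : ℕ), (m : ℝ) > c₀ * n →
      ∀ (x : EuclideanSpace ℝ (Fin n))
        (Ω : Type u) [MeasurableSpace Ω] (P : Measure Ω) [IsProbabilityMeasure P]
        (a : Fin m → Ω → EuclideanSpace ℝ (Fin n)) (w η : Fin m → Ω → ℝ),
        (∀ i j, HasLaw (fun ω => a i ω j) (gaussianReal 0 1) P) →
        iIndepFun (fun (p : Fin m × Fin n) ω => a p.1 ω p.2) P →
        (∀ᵐ ω ∂P, ∀ i, |w i ω| ≤ c * ‖x‖ ^ 2) →
        (∀ᵐ ω ∂P, ((Finset.univ.filter fun i => η i ω ≠ 0).card : ℝ) ≤ s * m) →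
        P {ω | ¬ ∀ z, IsSpectralInit κ α (fun i => a i ω)
              (measurements (fun i => a i ω) x (fun i => w i ω) (fun i => η i ω)) z →
            signDist z x ≤ δ * ‖x‖}
          ≤ ENNReal.ofReal (Real.exp (-(C * m))) := by
  set θ := chiSqMedian with hθ
  have hθ0 : 0 < θ := chiSqMedian_pos
  obtain ⟨hκ, hδ, hT15⟩ : 0 < κ ∧ |√(θ / κ) - 1| < δ ∧ 15 / (α ^ 2 * θ / κ) < 2 := by
    have hα2 : 9 ≤ α ^ 2 := by nlinarith
    rcases hκδ with ⟨rfl, h⟩ | ⟨rfl, h⟩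
    · refine ⟨hθ0, by simpa [div_self hθ0.ne'] using h, ?_⟩
      rw [mul_div_assoc, div_self hθ0.ne', mul_one, div_lt_iff₀ (by positivity)]
      linarith
    · refine ⟨by norm_num, h, ?_⟩
      have h1 : Real.pi / 8 ≤ θ := pi_div_eight_le_chiSqMedian
      have h2 := Real.pi_gt_d2
      rw [div_lt_iff₀ (by positivity), mul_div_assoc', lt_div_iff₀ (by norm_num)]
      have h3 : 9 * θ ≤ α ^ 2 * θ := by gcongr
      norm_num at *
      linarith
  set T := α ^ 2 * θ / κ with hT
  have hα0 : 0 < α := by linarith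
  have hT0 : 0 < T := by positivity
  set A := ∫ t, truncSq T t * t ^ 2 ∂(gaussianReal 0 1) with hA
  set B := ∫ t, truncSq T t ∂(gaussianReal 0 1) with hB
  have hAB : 0 < A - B := by linarith [two_sub_le_integral_truncSq_gap hT0]
  -- Half of the slack in `δ` goes to the scale, half to the direction: `ξ = d ^ 2 / 2` gives `√(2 *
  -- ξ) = d`.
  set d := (δ - |√(θ / κ) - 1|) / 2 with hd
  have hd0 : 0 < d := by rw [hd]; linarith
  -- The error budget of `hξ`. Dense noise, bad indices, the tail `3 / L` and the deviations `τ`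
  -- each get a quarter, which fixes `c`, `β`, `L` and `τ`.
  set Δ := (A - B) * (d ^ 2 / 2) with hΔ
  have hΔ0 : 0 < Δ := by positivity
  set K := 2 * T + 1 with hK
  have hK0 : 0 < K := by positivity
  set τ := Δ / (8 * (K + 1)) with hτ
  have hτ0 : 0 < τ := by positivity
  set L := 24 * K / Δ with hL
  have hL0 : 0 < L := by positivity
  set β := Δ / (16 * K * L) with hβ
  have hβ0 : 0 < β := by positivity
  obtain ⟨ε', hε'0, hε'⟩ := exists_gaussianReal_abs_sq_sub_le (T := T) hβ0
  set e := min (ε' / 2) 1 with he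
  have he0 : 0 < e := by positivity
  obtain ⟨ρ, hρ0, hρ⟩ : ∃ ρ > 0, ∀ h, |h| ≤ ρ → |√((θ + h) / κ) - 1| < |√(θ / κ) - 1| + d := by
    have hcont : Continuous fun h : ℝ => |√((θ + h) / κ) - 1| := by fun_prop
    have h2 := (hcont.tendsto 0).eventually_lt_const
      (show |√((θ + 0) / κ) - 1| < |√(θ / κ) - 1| + d by simpa using hd0)
    obtain ⟨ρ, hρ0, hρ⟩ := Metric.eventually_nhds_iff_ball.1 h2
    refine ⟨ρ / 2, by positivity, fun h hh => hρ h ?_⟩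
    rw [mem_ball_zero_iff, Real.norm_eq_abs]
    linarith
  -- Every tolerance is halved because `c ≤ ε` will make the median error at most `2 * ε`.
  set ε := min (min (ρ / 2) (θ / 2)) (e * κ / (2 * α ^ 2)) with hε
  have hε0 : 0 < ε := by positivity
  have hερ : 2 * ε ≤ ρ := by
    linarith [(min_le_left _ _ : ε ≤ min (ρ / 2) (θ / 2)), min_le_left (ρ / 2) (θ / 2)]
  have hεθ : 2 * ε ≤ θ := by
    linarith [(min_le_left _ _ : ε ≤ min (ρ / 2) (θ / 2)), min_le_right (ρ / 2) (θ / 2)]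
  have hεe : α ^ 2 / κ * (2 * ε) ≤ e := by
    have h1 : ε ≤ e * κ / (2 * α ^ 2) := min_le_right _ _
    rw [le_div_iff₀ (by positivity)] at h1
    rw [div_mul_eq_mul_div, div_le_iff₀ hκ]
    linarith
  have hlo := gaussianReal_sq_le_lt_half (t := θ - ε) (by linarith)
  have hhi : (gaussianReal 0 1).real {x | ¬ x ^ 2 ≤ θ + ε} < 1 / 2 := by
    have h1 := half_lt_gaussianReal_sq_le (t := θ + ε) (by linarith)
    have h2 := probReal_compl_eq_one_sub (μ := gaussianReal 0 1) (s := {x : ℝ | x ^ 2 ≤ θ + ε})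
      (measurableSet_le (by fun_prop) (by fun_prop))
    have h3 : {x : ℝ | ¬ x ^ 2 ≤ θ + ε} = {x : ℝ | x ^ 2 ≤ θ + ε}ᶜ := rfl
    rw [h3, h2]
    linarith
  set s := min (min β (1 / 4)) (min ((1 / 2 - (gaussianReal 0 1).real {x | x ^ 2 ≤ θ - ε}) / 2)
    ((1 / 2 - (gaussianReal 0 1).real {x | ¬ x ^ 2 ≤ θ + ε}) / 2)) with hs
  have hs0 : 0 < s := by
    refine lt_min (lt_min hβ0 (by norm_num)) (lt_min ?_ ?_) <;> linarith
  have hsβ : s ≤ β := (min_le_left _ _).trans (min_le_left _ _)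
  have hs4 : s ≤ 1 / 4 := (min_le_left _ _).trans (min_le_right _ _)
  have hslo : (gaussianReal 0 1).real {x | x ^ 2 ≤ θ - ε} < 1 / 2 - s := by
    have : s ≤ (1 / 2 - (gaussianReal 0 1).real {x | x ^ 2 ≤ θ - ε}) / 2 :=
      (min_le_right _ _).trans (min_le_left _ _)
    linarith
  have hshi : (gaussianReal 0 1).real {x | ¬ x ^ 2 ≤ θ + ε} < 1 / 2 - s := by
    have : s ≤ (1 / 2 - (gaussianReal 0 1).real {x | ¬ x ^ 2 ≤ θ + ε}) / 2 :=
      (min_le_right _ _).trans (min_le_right _ _)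
    linarith
  set c := min (min ε (ε' / 2)) (Δ / 32) with hc
  have hc0 : 0 < c := by positivity
  have hcε : c ≤ ε := (min_le_left _ _).trans (min_le_left _ _)
  have hcε' : c ≤ ε' / 2 := (min_le_left _ _).trans (min_le_right _ _)
  have hcΔ : c ≤ Δ / 32 := min_le_right _ _
  have hξ : 2 * (4 * c + K * (L * (β + s) + (3 / L + τ))) + 2 * τ ≤ (A - B) * (d ^ 2 / 2) := by
    rw [← hΔ]
    have h1 : K * (L * (β + s)) ≤ Δ / 8 := by
      have h : K * (L * (2 * β)) = Δ / 8 := by rw [hβ]; field_simp; norm_num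
      rw [← h]
      gcongr
      linarith
    have h2 : K * (3 / L) = Δ / 8 := by rw [hL]; field_simp; norm_num
    have h3 : K * τ + τ = Δ / 8 := by rw [hτ]; field_simp
    linarith
  have hrare := (((((((expRare_card.{u} (p := fun t => t ^ 2 ≤ θ - ε)
      (measurableSet_le (by fun_prop) (by fun_prop)) hslo).or
    (expRare_card.{u} (p := fun t => ¬ t ^ 2 ≤ θ + ε)
      (show MeasurableSet {t : ℝ | t ^ 2 ≤ θ + ε} from
        measurableSet_le (by fun_prop) (by fun_prop)).compl hshi)).or
    (expRare_card.{u} (p := fun t => |t ^ 2 - T| ≤ ε')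
      (measurableSet_le (by fun_prop) (by fun_prop)) hε')).or
    expRare_sum_sq_inner.{u}).or (expRare_excess.{u} hL0 hτ0)).or
    (expRare_truncSq_upper.{u} hT0 hτ0)).or (expRare_truncSq_lower.{u} hT0 hτ0))
  obtain ⟨c₀, C, hc₀, hC, hrare⟩ := hrare
  refine ⟨c, s, c₀, C, hc0, hs0, hc₀, hC, fun n m hnm x Ω _ P _ a w η hlaw hind hw hη => ?_⟩
  have hm : 0 < m := by
    have : (0 : ℝ) < m := lt_of_le_of_lt (by positivity) hnm
    exact_mod_cast this
  -- A zero signal has no direction `u`, but then the dense noise vanishes and the median, hence the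
  -- output, is almost surely 0.
  by_cases hx : x = 0
  · subst hx
    refine le_of_eq_of_le ?_ zero_le
    rw [← ae_iff]
    filter_upwards [hw, hη] with ω hw hη z hz
    rw [norm_zero, mul_zero]
    exact signDist_le_of_signal_eq_zero hm (by linarith) (by simpa using hw) hη hz
  have hx0 : 0 < ‖x‖ := norm_pos_iff.2 hx
  have hu : ‖(‖x‖⁻¹ : ℝ) • x‖ = 1 := by
    rw [norm_smul, norm_inv, norm_norm, inv_mul_cancel₀ hx0.ne']
  refine (measure_mono_ae ?_).trans (hrare n m hnm ((‖x‖⁻¹ : ℝ) • x) hu Ω P a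
    (hasLaw_row_stdGaussian hlaw hind) (iIndepFun_rows hlaw hind))
  filter_upwards [hw, hη] with ω hw hη hbad
  by_contra hgood
  refine hbad fun z hz => ?_
  replace hgood : ¬ (_ ∨ _) := hgood
  simp only [not_or, not_exists, not_and, not_le, not_lt] at hgood
  obtain ⟨⟨⟨⟨⟨⟨h1, h2⟩, h3⟩, h4⟩, h5⟩, h6⟩, h7⟩ := hgood
  refine signDist_le_of_regular hm hx hu (by rw [smul_smul, mul_inv_cancel₀ hx0.ne', one_smul]) hκ hT
    hT0.le hc0.le hL0.le (by linarith) hw hη h1 (by simpa only [not_le] using h2) h3.le h4 h5 h6 h7.le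
    (e := e) ?_ (min_le_right _ _) ?_ hAB hξ (fun h hh => ?_) hz
  · refine le_trans ?_ hεe
    gcongr
    linarith
  · linarith [min_le_left (ε' / 2) 1]
  · have h8 := hρ h (by linarith)
    have h9 : √(2 * (d ^ 2 / 2)) = d := by
      rw [mul_div_cancel₀ _ two_ne_zero, Real.sqrt_sq hd0.le]
    rw [h9]
    linarith

end MedianSpectral

end

theorem proposition2
    (α : ℝ) (hα : 3 ≤ α) (κ δ : ℝ)
    (hκδ : (κ = MedianSpectral.chiSqMedian ∧ 0 < δ) ∨
      (κ = 0.455 ∧ |√(MedianSpectral.chiSqMedian / κ) - 1| < δ)) :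
    ∃ c s c₀ C : ℝ, 0 < c ∧ 0 < s ∧ 0 < c₀ ∧ 0 < C ∧
      ∀ (n m : ℕ), (m : ℝ) > c₀ * n →
      ∀ (x : EuclideanSpace ℝ (Fin n))
        (Ω : Type*) [MeasurableSpace Ω] (P : Measure Ω) [IsProbabilityMeasure P]
        (a : Fin m → Ω → EuclideanSpace ℝ (Fin n)) (w η : Fin m → Ω → ℝ),
        (∀ i j, HasLaw (fun ω => a i ω j) (gaussianReal 0 1) P) →
        iIndepFun (fun (p : Fin m × Fin n) ω => a p.1 ω p.2) P →
        (∀ᵐ ω ∂P, ∀ i, |w i ω| ≤ c * ‖x‖ ^ 2) →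
        (∀ᵐ ω ∂P, ((Finset.univ.filter fun i => η i ω ≠ 0).card : ℝ) ≤ s * m) →
        P {ω | ¬ ∀ z, MedianSpectral.IsSpectralInit κ α (fun i => a i ω)
              (MedianSpectral.measurements (fun i => a i ω) x (fun i => w i ω) (fun i => η i ω)) z →
            MedianSpectral.signDist z x ≤ δ * ‖x‖}
          ≤ ENNReal.ofReal (Real.exp (-(C * m))) :=
  MedianSpectral.exists_constants_signDist_le α hα κ δ hκδ
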